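/- Let $\mathbb{F}$ be an algebraically closed field and $d\ge 3$ an integer. A square matrix is irreducible tridiagonal if its nonzero entries all lie on the diagonal, subdiagonal or superdiagonal, and all entries of the subdiagonal and superdiagonal are nonzero. A Leonard pair on a vector space $V$ over $\mathbb{F}$ of dimension $d+1$ is a pair of linear maps $A,A^*:V\to V$ such that in some basis of $V$ the matrix of $A$ is irreducible tridiagonal and that of $A^*$ is diagonal, and in some basis of $V$ the matrix of $A^*$ is irreducible tridiagonal and that of $A$ is diagonal. Then each of $A,A^*$ has $d+1$ distinct eigenvalues; the primitive idempotent of $A$ for an eigenvalue is the projection that is the identity on its eigenspace and zero on the other eigenspaces of $A$, and similarly for $A^*$. An ordering $E_0,\dots,E_d$ of the primitive idempotents of $A$ is standard if, in a basis of eigenvectors $v_i\in E_iV$ taken in this order, the matrix of $A^*$ is irreducible tridiagonal; a standard ordering $E^*_0,\dots,E^*_d$ for $A^*$ is defined likewise with the roles of $A,A^*$ exchanged. A Leonard system of diameter $d$ over $\mathbb{F}$ is a sequence $\Phi=(A,\{E_i\}_{i=0}^d,A^*,\{E^*_i\}_{i=0}^d)$ with $A,A^*$ a Leonard pair on such a $V$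 and $\{E_i\}$, $\{E^*_i\}$ standard orderings of the primitive idempotents of $A$ and $A^*$. For such $\Phi$ let $\theta_i$ (resp. $\theta^*_i$) be the eigenvalue of $A$ (resp. $A^*$) associated with $E_i$ (resp. $E^*_i$), put $a_i=\mathrm{tr}(AE^*_i)$ and $a^*_i=\mathrm{tr}(A^*E_i)$ for $0\le i\le d$, and for $1\le i\le d$ put $$\varphi_i=(\theta^*_0-\theta^*_i)\frac{\mathrm{tr}\bigl(E^*_0\prod_{h=0}^{i-1}(A-\theta_hI)\bigr)}{\mathrm{tr}\bigl(E^*_0\prod_{h=0}^{i-2}(A-\theta_hI)\bigr)},\qquad \phi_i=(\theta^*_0-\theta^*_i)\frac{\mathrm{tr}\bigl(E^*_0\prod_{h=0}^{i-1}(A-\theta_{d-h}I)\bigr)}{\mathrm{tr}\bigl(E^*_0\prod_{h=0}^{i-2}(A-\theta_{d-h}I)\bigr)}$$ (the denominators are nonzero). The fundamental parameter of $\Phi$ is one less than the common value of the expressions $(\theta_{i-2}-\theta_{i+1})/(\theta_{i-1}-\theta_i)$ and $(\theta^*_{i-2}-\theta^*_{i+1})/(\theta^*_{i-1}-\theta^*_i)$,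 which are equal and independent of $i$ for $2\le i\le d-1$. The end-entries of $\Phi$ are $\theta_0,\theta_d,\theta^*_0,\theta^*_d,a_0,a_d,a^*_0,a^*_d$. **Theorem.** Let $\Phi$ be a Leonard system over $\mathbb{F}$ of diameter $d\ge 3$ with $\varphi_1+\varphi_d\ne\phi_1+\phi_d$. Let $\Phi'=(A',\{E'_i\},A^{*\prime},\{E^{*\prime}_i\})$, on a vector space $V'$, be any Leonard system over $\mathbb{F}$ of diameter $d$ that has the same fundamental parameter and the same end-entries as $\Phi$. Then $\Phi'$ is isomorphic to $\Phi$: there is a linear bijection $\sigma:V'\to V$ with $\sigma A'=A\sigma$, $\sigma A^{*\prime}=A^*\sigma$, and $\sigma E'_i=E_i\sigma$, $\sigma E^{*\prime}_i=E^*_i\sigma$ for $0\le i\le d$. -/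

import Mathlib

open Module

/-- A square matrix is irreducible tridiagonal: every nonzero entry lies on the diagonal, the
subdiagonal or the superdiagonal, and every entry of the subdiagonal and of the superdiagonal
is nonzero. -/
def IsIrredTridiagonal {F : Type*} [Field F] {n : ℕ} (M : Matrix (Fin n) (Fin n) F) : Prop :=
  (∀ i j : Fin n, M i j ≠ 0 →
    (i : ℕ) = j ∨ (i : ℕ) = (j : ℕ) + 1 ∨ (j : ℕ) = (i : ℕ) + 1) ∧
  (∀ i j : Fin n, ((i : ℕ) = (j : ℕ) + 1 ∨ (j : ℕ) = (i : ℕ) + 1) → M i j ≠ 0)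

section Pair

variable {F : Type*} [Field F] {V : Type*} [AddCommGroup V] [Module F V]

/-- With respect to the basis `b`, the matrix representing `X` is irreducible tridiagonal and the
matrix representing `Y` is diagonal. -/
def IsTridiagonalDiagonal {n : ℕ} (b : Basis (Fin n) F V) (X Y : End F V) : Prop :=
  IsIrredTridiagonal (LinearMap.toMatrix b b X) ∧ (LinearMap.toMatrix b b Y).IsDiag

/-- `A, Astar` is a Leonard pair on the vector space `V` of dimension `d + 1`. -/
def IsLeonardPair (d : ℕ) (A Astar : End F V) : Prop :=
  (∃ b : Basis (Fin (d + 1)) F V, IsTridiagonalDiagonal b A Astar) ∧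
  (∃ b : Basis (Fin (d + 1)) F V, IsTridiagonalDiagonal b Astar A)

/-- `θ` is an ordering of the (mutually distinct) eigenvalues of `A`, and `E i` is the primitive
idempotent of `A` associated with `θ i`: it is the identity on the eigenspace of `θ i` and zero on
the eigenspace of `θ j` for `j ≠ i`. -/
structure IsPrimitiveIdempotents {d : ℕ} (A : End F V) (θ : Fin (d + 1) → F)
    (E : Fin (d + 1) → End F V) : Prop where
  injective : Function.Injective θ
  hasEigenvalue_iff : ∀ μ : F, A.HasEigenvalue μ ↔ ∃ i, θ i = μ
  apply_self : ∀ i, ∀ v ∈ A.eigenspace (θ i), E i v = v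
  apply_of_ne : ∀ i j, j ≠ i → ∀ v ∈ A.eigenspace (θ j), E i v = 0

/-- The ordering `E` of the primitive idempotents of `A`, with eigenvalue ordering `θ`, is standard
(with respect to `B`): a basis consisting of one eigenvector of `A` for each `θ i`, in this order,
represents `B` by an irreducible tridiagonal matrix (and `A` by a diagonal one). -/
def IsStandardOrdering {d : ℕ} (A B : End F V) (E : Fin (d + 1) → End F V) : Prop :=
  ∃ θ : Fin (d + 1) → F, IsPrimitiveIdempotents A θ E ∧
    ∃ b : Basis (Fin (d + 1)) F V,
      (∀ i, b i ∈ A.eigenspace (θ i)) ∧ IsTridiagonalDiagonal b B A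

/-- The eigenvalue ordering attached to an ordering of the primitive idempotents is unique. -/
theorem IsPrimitiveIdempotents.unique {d : ℕ} {A : End F V} {θ θ' : Fin (d + 1) → F}
    {E : Fin (d + 1) → End F V} (h : IsPrimitiveIdempotents A θ E)
    (h' : IsPrimitiveIdempotents A θ' E) : θ = θ' := by
  funext i
  obtain ⟨j, hj⟩ := (h'.hasEigenvalue_iff (θ i)).1 ((h.hasEigenvalue_iff (θ i)).2 ⟨i, rfl⟩)
  by_cases hij : j = i
  · rw [← hj, hij]
  · obtain ⟨v, hv⟩ := ((h.hasEigenvalue_iff (θ i)).2 ⟨i, rfl⟩).exists_hasEigenvector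
    have h1 := h.apply_self i v hv.1
    have h2 := h'.apply_of_ne i j hij v (by rw [hj]; exact hv.1)
    exact absurd (h1.symm.trans h2) hv.2

end Pair

/-- A Leonard system `(A, {E_i}, A*, {E*_i})` on `V` over `F` of diameter `d`. -/
structure LeonardSystem (F : Type*) [Field F] (V : Type*) [AddCommGroup V] [Module F V]
    (d : ℕ) where
  A : End F V
  E : Fin (d + 1) → End F V
  Astar : End F V
  Estar : Fin (d + 1) → End F V
  isLeonardPair : IsLeonardPair d A Astar
  standard : IsStandardOrdering A Astar E
  standard_star : IsStandardOrdering Astar A Estar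

namespace LeonardSystem

section

variable {F : Type*} [Field F] {V : Type*} [AddCommGroup V] [Module F V] {d : ℕ}

/-- `Φ.θ i` is the eigenvalue of `A` associated with `E i`. -/
noncomputable def θ (Φ : LeonardSystem F V d) : Fin (d + 1) → F :=
  Φ.standard.choose

theorem isPrimitiveIdempotents (Φ : LeonardSystem F V d) :
    IsPrimitiveIdempotents Φ.A Φ.θ Φ.E :=
  Φ.standard.choose_spec.1

/-- `Φ.θstar i` is the eigenvalue of `A*` associated with `E* i`. -/
noncomputable def θstar (Φ : LeonardSystem F V d) : Fin (d + 1) → F :=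
  Φ.standard_star.choose

theorem isPrimitiveIdempotents_star (Φ : LeonardSystem F V d) :
    IsPrimitiveIdempotents Φ.Astar Φ.θstar Φ.Estar :=
  Φ.standard_star.choose_spec.1

/-- `tr (E*_0 (A - t_0 I) (A - t_1 I) ⋯ (A - t_{k-1} I))`. -/
noncomputable def splitTrace (Φ : LeonardSystem F V d) (t : Fin (d + 1) → F) (k : ℕ) : F :=
  LinearMap.trace F V (Φ.Estar 0 *
    Polynomial.aeval Φ.A
      (∏ h ∈ Finset.univ.filter (fun h : Fin (d + 1) => (h : ℕ) < k),
        (Polynomial.X - Polynomial.C (t h))))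

/-- The scalars `varphi_i` (`1 ≤ i ≤ d`) of the parameter array; the value at `i = 0` has no
meaning. -/
noncomputable def vphi (Φ : LeonardSystem F V d) (i : Fin (d + 1)) : F :=
  (Φ.θstar 0 - Φ.θstar i) * (Φ.splitTrace Φ.θ i / Φ.splitTrace Φ.θ ((i : ℕ) - 1))

/-- The scalars `phi_i` (`1 ≤ i ≤ d`) of the parameter array, where `θ_{d-h}` takes the place of
`θ_h`; the value at `i = 0` has no meaning. -/
noncomputable def phi (Φ : LeonardSystem F V d) (i : Fin (d + 1)) : F :=
  (Φ.θstar 0 - Φ.θstar i) *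
    (Φ.splitTrace (fun h => Φ.θ h.rev) i / Φ.splitTrace (fun h => Φ.θ h.rev) ((i : ℕ) - 1))

/-- The fundamental parameter, for `d ≥ 3`: one less than the common value of
`(θ_{i-2} - θ_{i+1}) / (θ_{i-1} - θ_i)` and `(θ*_{i-2} - θ*_{i+1}) / (θ*_{i-1} - θ*_i)` for
`2 ≤ i ≤ d - 1`. These expressions all agree for a Leonard system; the common value is read off
from the first one at `i = 2`. -/
noncomputable def fundamentalParameter (Φ : LeonardSystem F V d) (hd : 3 ≤ d) : F :=
  (Φ.θ ⟨0, by omega⟩ - Φ.θ ⟨3, by omega⟩) / (Φ.θ ⟨1, by omega⟩ - Φ.θ ⟨2, by omega⟩) - 1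

/-- The principal sequence `a_i = tr (A E*_i)`. -/
noncomputable def a (Φ : LeonardSystem F V d) (i : Fin (d + 1)) : F :=
  LinearMap.trace F V (Φ.A * Φ.Estar i)

/-- The dual principal sequence `a*_i = tr (A* E_i)`. -/
noncomputable def astar (Φ : LeonardSystem F V d) (i : Fin (d + 1)) : F :=
  LinearMap.trace F V (Φ.Astar * Φ.E i)

/-- The end-entries `θ_0, θ_d, θ*_0, θ*_d, a_0, a_d, a*_0, a*_d`. -/
noncomputable def endEntries (Φ : LeonardSystem F V d) : Fin 8 → F :=
  ![Φ.θ 0, Φ.θ (Fin.last d), Φ.θstar 0, Φ.θstar (Fin.last d),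
    Φ.a 0, Φ.a (Fin.last d), Φ.astar 0, Φ.astar (Fin.last d)]

/-- There is an isomorphism of Leonard systems from `Φ` to `Φ'`. -/
def IsIsomorphic {V' : Type*} [AddCommGroup V'] [Module F V']
    (Φ : LeonardSystem F V d) (Φ' : LeonardSystem F V' d) : Prop :=
  ∃ σ : V ≃ₗ[F] V',
    (∀ v, σ (Φ.A v) = Φ'.A (σ v)) ∧
    (∀ v, σ (Φ.Astar v) = Φ'.Astar (σ v)) ∧
    (∀ i v, σ (Φ.E i v) = Φ'.E i (σ v)) ∧
    (∀ i v, σ (Φ.Estar i v) = Φ'.Estar i (σ v))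

end

end LeonardSystem

/-! In an eigenbasis of `A*` the map `A` is an irreducible tridiagonal matrix `T`; in an eigenbasis
of `A` the map `A*` is such a matrix `B`. Up to a diagonal change of basis `T` is determined by its
diagonal and the products of opposite off-diagonal entries, so it suffices to recover these and both
eigenvalue sequences from the given data.

Eigenvalues (`eigenvalues_eq`): both sequences satisfy three-term recurrences with one common `β`,
the fundamental parameter, so each is fixed by its terms at `0, 1, d`, and `θs_1 - θs_{d-1}` is
known. `first_relation`, read at several corners by reversing the orderings, determines the ratio of
`θs_0 - θs_1` to `θs_d - θs_{d-1}`. Ratio and difference together determine `θs_1` unless the ratio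
is `1`; by `vphi_add_sub` this is exactly what the hypothesis on the split parameters excludes. Then
`θ_1` follows.

Matrix entries (`mul_eq_of_ends`): the Askey-Wilson relation `A²A* - βAA*A + A*A² - γ(AA* + A*A) -
ρA* = γsA² + ωA + η` has `β, γ, γs, ρ` determined by the eigenvalues, and `ω, η` by the end diagonal
entries. Its diagonal in the eigenbasis of `A`, and that of its dual in the eigenbasis of `A*`, give
all diagonal entries; its diagonal in the eigenbasis of `A*` gives the off-diagonal products one
after another. -/

/-! ### Three-term recurrences -/

section Recurrence

variable {F : Type*} [Field F]

/-- The Chebyshev-type sequence `0, 1, β, β² - 1, …`. -/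
def chebyshevSeq (β : F) : ℕ → F
  | 0 => 0
  | 1 => 1
  | n + 2 => β * chebyshevSeq β (n + 1) - chebyshevSeq β n

/-- The solution of `s_{n+2} - β s_{n+1} + s_n = 1` with `s_0 = s_1 = 0`. -/
def chebyshevSum (β : F) : ℕ → F
  | 0 => 0
  | 1 => 0
  | n + 2 => β * chebyshevSum β (n + 1) - chebyshevSum β n + 1

/-- One step of the recurrence has determinant `1`, so this Casoratian is constant in `k`. -/
theorem chebyshevSeq_sq_sub (β : F) (k : ℕ) :
    chebyshevSeq β (k + 1) ^ 2 - chebyshevSeq β k * chebyshevSeq β (k + 2) = 1 := by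
  induction k with
  | zero => simp [chebyshevSeq]
  | succ k ih =>
    have h1 : chebyshevSeq β (k + 2) = β * chebyshevSeq β (k + 1) - chebyshevSeq β k := rfl
    have h2 : chebyshevSeq β (k + 3) = β * chebyshevSeq β (k + 2) - chebyshevSeq β (k + 1) := rfl
    rw [show k + 1 + 1 = k + 2 from rfl, show k + 1 + 2 = k + 3 from rfl, h2, h1]
    rw [h1] at ih
    linear_combination ih

/-- The factors are the coefficients in `IsThreeTerm.sub_even` and `IsThreeTerm.sub_odd`; this is
what links `chebyshevSum` to differences of eigenvalues. -/
theorem chebyshevSum_eq (β : F) (k : ℕ) :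
    chebyshevSum β (2 * k + 1) =
        chebyshevSeq β k * (chebyshevSeq β k + chebyshevSeq β (k + 1)) ∧
      chebyshevSum β (2 * k + 2) =
        chebyshevSeq β (k + 1) * (chebyshevSeq β k + chebyshevSeq β (k + 1)) := by
  induction k with
  | zero => simp [chebyshevSeq, chebyshevSum]
  | succ k ih =>
    obtain ⟨h1, h2⟩ := ih
    have hc := chebyshevSeq_sq_sub β k
    have hU : chebyshevSeq β (k + 2) = β * chebyshevSeq β (k + 1) - chebyshevSeq β k := rfl
    have e1 : chebyshevSum β (2 * (k + 1) + 1) =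
        β * chebyshevSum β (2 * k + 2) - chebyshevSum β (2 * k + 1) + 1 := rfl
    have e2 : chebyshevSum β (2 * (k + 1) + 2) =
        β * chebyshevSum β (2 * (k + 1) + 1) - chebyshevSum β (2 * k + 2) + 1 := rfl
    have h3 : chebyshevSum β (2 * (k + 1) + 1) =
        chebyshevSeq β (k + 1) * (chebyshevSeq β (k + 1) + chebyshevSeq β (k + 1 + 1)) := by
      rw [e1, h1, h2, show k + 1 + 1 = k + 2 from rfl]
      rw [hU] at hc ⊢
      linear_combination -hc
    refine ⟨h3, ?_⟩
    rw [e2, h3, h2, show k + 1 + 1 = k + 2 from rfl]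
    rw [hU] at hc ⊢
    linear_combination -hc

/-- `t_0, …, t_d` satisfies the three-term recurrence `t_i + t_{i+2} = β t_{i+1} + γ`. -/
def IsThreeTerm (d : ℕ) (β γ : F) (t : ℕ → F) : Prop :=
  ∀ i, i + 2 ≤ d → t i + t (i + 2) = β * t (i + 1) + γ

variable {d : ℕ} {β γ : F} {t : ℕ → F}

/-- Differences of terms symmetric about the fixed centre `c + 1` cancel `γ`, so as functions of the
half-width `k` they obey the homogeneous recurrence. -/
theorem IsThreeTerm.sub_even (h : IsThreeTerm d β γ t) (k : ℕ) :
    (∀ r, r + 2 * k ≤ d → ∀ c, c + 1 = r + k → c + 2 ≤ d →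
      t r - t (r + 2 * k) = chebyshevSeq β k * (t c - t (c + 2))) := by
  induction k using Nat.twoStepInduction with
  | zero => intro r _ c _ _; simp [chebyshevSeq]
  | one =>
    intro r _ c hc _
    obtain rfl : c = r := by omega
    simp [chebyshevSeq]
  | more k h1 h2 =>
    intro r hr c hc hcd
    have e1 := h1 (r + 2) (by omega) c (by omega) hcd
    have e2 := h2 (r + 1) (by omega) c (by omega) hcd
    have r1 := h r (by omega)
    have r2 := h (r + 2 * k + 2) (by omega)
    rw [show r + 2 + 2 * k = r + 2 * k + 2 by ring] at e1
    rw [show r + 1 + 2 * (k + 1) = r + 2 * k + 2 + 1 by ring] at e2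
    rw [show r + 2 * (k + 2) = r + 2 * k + 2 + 2 by ring]
    simp only [chebyshevSeq]
    linear_combination r1 - r2 - e1 + β * e2

/-- The same argument about a centre midway between `c` and `c + 1`; the initial coefficients are
now `1` and `1 + β`. -/
theorem IsThreeTerm.sub_odd (h : IsThreeTerm d β γ t) (k : ℕ) :
    (∀ r, r + 2 * k + 1 ≤ d → ∀ c, c = r + k →
      t r - t (r + 2 * k + 1) =
        (chebyshevSeq β k + chebyshevSeq β (k + 1)) * (t c - t (c + 1))) := by
  induction k using Nat.twoStepInduction with
  | zero => rintro r _ c rfl; simp [chebyshevSeq]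
  | one =>
    rintro r hr c rfl
    have r1 := h r (by omega)
    have r2 := h (r + 1) (by omega)
    simp only [chebyshevSeq, mul_one] at *
    rw [show r + 2 + 1 = r + 1 + 2 by ring]
    linear_combination r1 - r2
  | more k h1 h2 =>
    intro r hr c hc
    have e1 := h1 (r + 2) (by omega) c (by omega)
    have e2 := h2 (r + 1) (by omega) c (by omega)
    have r1 := h r (by omega)
    have r2 := h (r + 2 * k + 3) (by omega)
    rw [show r + 2 + 2 * k + 1 = r + 2 * k + 3 by ring] at e1
    rw [show r + 1 + 2 * (k + 1) + 1 = r + 2 * k + 3 + 1 by ring] at e2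
    rw [show r + 2 * (k + 2) + 1 = r + 2 * k + 3 + 2 by ring]
    simp only [chebyshevSeq] at *
    linear_combination r1 - r2 - e1 + β * e2

/-- The ratio of `t_1 - t_{d-1}` to `t_0 - t_d` depends on `β` and `d` only. -/
theorem IsThreeTerm.sub_mul_sub (h : IsThreeTerm d β γ t) {γ' : F} {t' : ℕ → F}
    (h' : IsThreeTerm d β γ' t') (hd : 2 ≤ d) :
    (t 1 - t (d - 1)) * (t' 0 - t' d) = (t' 1 - t' (d - 1)) * (t 0 - t d) := by
  -- Both differences have the same centre, so they are multiples of one central difference with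
  -- coefficients depending on `β` and `d` only.
  rcases Nat.even_or_odd' d with ⟨m, rfl | rfl⟩
  · obtain ⟨m, rfl⟩ : ∃ k, m = k + 1 := ⟨m - 1, by omega⟩
    have a1 := h.sub_even (m + 1) 0 (by omega) m (by omega) (by omega)
    have a2 := h.sub_even m 1 (by omega) m (by omega) (by omega)
    have b1 := h'.sub_even (m + 1) 0 (by omega) m (by omega) (by omega)
    have b2 := h'.sub_even m 1 (by omega) m (by omega) (by omega)
    rw [show 1 + 2 * m = 2 * (m + 1) - 1 by omega] at a2 b2
    rw [Nat.zero_add] at a1 b1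
    rw [a1, a2, b1, b2]; ring
  · obtain ⟨m, rfl⟩ : ∃ k, m = k + 1 := ⟨m - 1, by omega⟩
    have a1 := h.sub_odd (m + 1) 0 (by omega) (m + 1) (by omega)
    have a2 := h.sub_odd m 1 (by omega) (m + 1) (by omega)
    have b1 := h'.sub_odd (m + 1) 0 (by omega) (m + 1) (by omega)
    have b2 := h'.sub_odd m 1 (by omega) (m + 1) (by omega)
    rw [show 1 + 2 * m + 1 = 2 * (m + 1) + 1 - 1 by omega] at a2 b2
    rw [Nat.zero_add] at a1 b1
    rw [a1, a2, b1, b2]; ring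

/-- Each factor of `chebyshevSum β d` multiplies a central difference to give `t 0 - t j` for some
`0 < j ≤ d`; if it vanished, two terms of `t` would coincide. -/
theorem IsThreeTerm.chebyshevSum_ne_zero (h : IsThreeTerm d β γ t)
    (hinj : ∀ i j, i < j → j ≤ d → t i ≠ t j) (hd : 2 ≤ d) : chebyshevSum β d ≠ 0 := by
  have hE : ∀ k, 1 ≤ k → 2 * k ≤ d → chebyshevSeq β k ≠ 0 := by
    intro k hk hkd h0
    have e := h.sub_even k 0 (by omega) (k - 1) (by omega) (by omega)
    rw [h0, zero_mul, sub_eq_zero] at e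
    exact hinj _ _ (by omega) (by omega) e
  have hO : ∀ k, 2 * k + 1 ≤ d → chebyshevSeq β k + chebyshevSeq β (k + 1) ≠ 0 := by
    intro k hkd h0
    have e := h.sub_odd k 0 (by omega) k (by omega)
    rw [h0, zero_mul, sub_eq_zero] at e
    exact hinj _ _ (by omega) (by omega) e
  rcases Nat.even_or_odd' d with ⟨m, rfl | rfl⟩
  · obtain ⟨m, rfl⟩ : ∃ k, m = k + 1 := ⟨m - 1, by omega⟩
    rw [show 2 * (m + 1) = 2 * m + 2 by ring, (chebyshevSum_eq β m).2]
    exact mul_ne_zero (hE _ (by omega) (by omega)) (hO _ (by omega))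
  · rw [(chebyshevSum_eq β m).1]
    exact mul_ne_zero (hE _ (by omega) (by omega)) (hO _ (by omega))

theorem IsThreeTerm.eq_mul_chebyshevSum (h : IsThreeTerm d β γ t) (h0 : t 0 = 0) (h1 : t 1 = 0)
    (i : ℕ) : i ≤ d → t i = γ * chebyshevSum β i := by
  induction i using Nat.twoStepInduction with
  | zero => simp [h0, chebyshevSum]
  | one => simp [h1, chebyshevSum]
  | more k e1 e2 =>
    intro hk
    have r := h k hk
    have e1 := e1 (by omega)
    have e2 := e2 (by omega)
    simp only [chebyshevSum]
    linear_combination r - e1 + β * e2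

/-- Two solutions for the same `β`, one of them injective, agree if they agree at `0, 1, d`. -/
theorem IsThreeTerm.eq_of_ends (h : IsThreeTerm d β γ t) {γ' : F} {t' : ℕ → F}
    (h' : IsThreeTerm d β γ' t') (hinj : ∀ i j, i < j → j ≤ d → t i ≠ t j) (hd : 2 ≤ d)
    (h0 : t' 0 = t 0) (h1 : t' 1 = t 1) (hlast : t' d = t d) (i : ℕ) (hi : i ≤ d) :
    t' i = t i := by
  -- The difference of the solutions vanishes at `0` and `1`, hence is `γ' - γ` times `chebyshevSum
  -- β`; its zero at `d` forces `γ' = γ`.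
  have hu : IsThreeTerm d β (γ' - γ) (fun i => t' i - t i) := fun i hi => by
    linear_combination h' i hi - h i hi
  have key := hu.eq_mul_chebyshevSum (by simp [h0]) (by simp [h1])
  have hd0 := key d le_rfl
  simp only [hlast, sub_self] at hd0
  have hγ : γ' - γ = 0 :=
    (mul_eq_zero.1 hd0.symm).resolve_right (h.chebyshevSum_ne_zero hinj hd)
  have := key i hi
  rw [hγ, zero_mul] at this
  exact sub_eq_zero.1 this

end Recurrence

/-! ### Band matrices and powers of a tridiagonal matrix -/

section Band

variable {F : Type*} [Field F] {n : ℕ}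

/-- The entries of `M` more than `r` places below the diagonal vanish. -/
def IsLowerBand (r : ℕ) (M : Matrix (Fin n) (Fin n) F) : Prop :=
  ∀ i j : Fin n, (j : ℕ) + r < i → M i j = 0

variable {M N T : Matrix (Fin n) (Fin n) F} {r s : ℕ}

theorem IsLowerBand.mul (hM : IsLowerBand r M) (hN : IsLowerBand s N) :
    IsLowerBand (r + s) (M * N) := by
  intro i j hij
  rw [Matrix.mul_apply]
  refine Finset.sum_eq_zero fun k _ => ?_
  by_cases hk : (j : ℕ) + s < k
  · rw [hN k j hk, mul_zero]
  · rw [hM i k (by omega), zero_mul]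

/-- On the extreme subdiagonal of a product only one intermediate index contributes. -/
theorem IsLowerBand.mul_apply (hM : IsLowerBand r M) (hN : IsLowerBand s N) (i k j : Fin n)
    (hk : (k : ℕ) = j + s) (hi : (i : ℕ) = k + r) : (M * N) i j = M i k * N k j := by
  rw [Matrix.mul_apply]
  refine Finset.sum_eq_single k (fun l _ hl => ?_) (by simp)
  by_cases hl' : (j : ℕ) + s < l
  · rw [hN l j hl', mul_zero]
  · have : (l : ℕ) ≠ k := fun h => hl (Fin.ext h)
    rw [hM i l (by omega), zero_mul]

theorem isLowerBand_diagonal (f : Fin n → F) : IsLowerBand 0 (Matrix.diagonal f) :=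
  fun i j hij => Matrix.diagonal_apply_ne _ (by rintro rfl; omega)

theorem IsIrredTridiagonal.isLowerBand (hT : IsIrredTridiagonal T) : IsLowerBand 1 T := by
  intro i j hij
  by_contra h
  have := hT.1 i j h
  omega

theorem IsLowerBand.pow (hT : IsLowerBand 1 T) (k : ℕ) : IsLowerBand k (T ^ k) := by
  induction k with
  | zero => rw [pow_zero, ← Matrix.diagonal_one]; exact isLowerBand_diagonal _
  | succ k ih => rw [pow_succ]; exact ih.mul hT

theorem IsIrredTridiagonal.pow_apply_ne_zero (hT : IsIrredTridiagonal T) (k : ℕ) (i j : Fin n)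
    (h : (i : ℕ) = j + k) : (T ^ k) i j ≠ 0 := by
  induction k generalizing j with
  | zero =>
    obtain rfl : i = j := Fin.ext (by omega)
    simp
  | succ k ih =>
    rw [pow_succ, (hT.isLowerBand.pow k).mul_apply hT.isLowerBand i ⟨j + 1, by omega⟩ j rfl
      (by simp; omega)]
    exact mul_ne_zero (ih _ (by simp; omega)) (hT.2 _ _ (by simp))

theorem IsLowerBand.aeval_band (hT : IsLowerBand 1 T) {p : Polynomial F} (hp : p.natDegree ≤ r) :
    IsLowerBand r (Polynomial.aeval T p) := by
  intro i j hij
  rw [Polynomial.aeval_eq_sum_range, Matrix.sum_apply]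
  refine Finset.sum_eq_zero fun k hk => ?_
  rw [Finset.mem_range] at hk
  rw [Matrix.smul_apply, hT.pow k i j (by omega), smul_zero]

/-- Lower powers do not reach the `r`-th subdiagonal, so that subdiagonal exposes the coefficient of
degree `r`. Degrees and leading coefficients of interpolating polynomials are read off this way. -/
theorem IsLowerBand.aeval_apply (hT : IsLowerBand 1 T) {p : Polynomial F} (hp : p.natDegree ≤ r)
    (i j : Fin n) (h : (i : ℕ) = j + r) : Polynomial.aeval T p i j = p.coeff r * (T ^ r) i j := by
  rw [Polynomial.aeval_eq_sum_range' (Nat.lt_succ_of_le hp), Matrix.sum_apply,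
    Finset.sum_eq_single r (fun k hk hkr => ?_) (by simp)]
  · simp
  · rw [Finset.mem_range] at hk
    rw [Matrix.smul_apply, hT.pow k i j (by omega), smul_zero]

theorem IsIrredTridiagonal.transpose (hT : IsIrredTridiagonal T) :
    IsIrredTridiagonal T.transpose :=
  ⟨fun i j h => by have := hT.1 j i h; omega, fun i j h => hT.2 j i (by omega)⟩

theorem IsIrredTridiagonal.submatrix_rev (hT : IsIrredTridiagonal T) :
    IsIrredTridiagonal (T.submatrix Fin.rev Fin.rev) := by
  refine ⟨fun i j h => ?_, fun i j h => hT.2 _ _ ?_⟩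
  · have := hT.1 _ _ h
    simp only [Fin.val_rev] at this
    omega
  · simp only [Fin.val_rev]
    omega

end Band

/-! ### Transition matrices, corner relations and split parameters -/

section LeonardMatrices

variable {F : Type*} [Field F] {d : ℕ}

/-- `T` represents `A` in an eigenbasis of `A*` (eigenvalues `θs`), `B` represents `A*` in an
eigenbasis of `A` (eigenvalues `θ`), and `P`, `Q` are the mutually inverse transition matrices
between the two bases. -/
structure IsLeonardMatrices (θ θs : Fin (d + 1) → F)
    (T B P Q : Matrix (Fin (d + 1)) (Fin (d + 1)) F) : Prop where
  inj : Function.Injective θ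
  inj_star : Function.Injective θs
  irred : IsIrredTridiagonal T
  irred_star : IsIrredTridiagonal B
  mul_inv : P * Q = 1
  inv_mul : Q * P = 1
  mul_diagonal : T * P = P * Matrix.diagonal θ
  diagonal_mul : Matrix.diagonal θs * P = P * B

namespace IsLeonardMatrices

variable {θ θs : Fin (d + 1) → F} {T B P Q : Matrix (Fin (d + 1)) (Fin (d + 1)) F}

/-- Duality. With `transpose`, `rev` and `rev_star` it carries a relation proved at one corner to
the other corners and to the dual. -/
theorem swap (h : IsLeonardMatrices θ θs T B P Q) : IsLeonardMatrices θs θ B T Q P where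
  inj := h.inj_star
  inj_star := h.inj
  irred := h.irred_star
  irred_star := h.irred
  mul_inv := h.inv_mul
  inv_mul := h.mul_inv
  mul_diagonal := by
    calc B * Q = Q * (P * B) * Q := by rw [← mul_assoc, h.inv_mul, one_mul]
      _ = Q * Matrix.diagonal θs := by
        rw [← h.diagonal_mul, mul_assoc, mul_assoc, h.mul_inv, mul_one]
  diagonal_mul := by
    calc Matrix.diagonal θ * Q = Q * (P * Matrix.diagonal θ) * Q := by
          rw [← mul_assoc, h.inv_mul, one_mul]
      _ = Q * T := by rw [← h.mul_diagonal, mul_assoc, mul_assoc, h.mul_inv, mul_one]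

theorem transpose (h : IsLeonardMatrices θ θs T B P Q) :
    IsLeonardMatrices θ θs T.transpose B.transpose Q.transpose P.transpose where
  inj := h.inj
  inj_star := h.inj_star
  irred := h.irred.transpose
  irred_star := h.irred_star.transpose
  mul_inv := by rw [← Matrix.transpose_mul, h.mul_inv, Matrix.transpose_one]
  inv_mul := by rw [← Matrix.transpose_mul, h.inv_mul, Matrix.transpose_one]
  mul_diagonal := by
    rw [← Matrix.transpose_mul, ← h.swap.diagonal_mul, Matrix.transpose_mul,
      Matrix.diagonal_transpose]
  diagonal_mul := by
    rw [← Matrix.transpose_mul, h.swap.mul_diagonal, Matrix.transpose_mul,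
      Matrix.diagonal_transpose]

theorem rev (h : IsLeonardMatrices θ θs T B P Q) :
    IsLeonardMatrices (fun i => θ i.rev) θs T (B.submatrix Fin.rev Fin.rev)
      (P.submatrix id Fin.rev) (Q.submatrix Fin.rev id) where
  inj := h.inj.comp Fin.rev_injective
  inj_star := h.inj_star
  irred := h.irred
  irred_star := h.irred_star.submatrix_rev
  mul_inv := by
    have := Matrix.submatrix_mul_equiv P Q id Fin.revPerm id
    rw [h.mul_inv] at this
    exact this.trans (Matrix.submatrix_one _ Function.injective_id)
  inv_mul := by
    have := Matrix.submatrix_mul_equiv Q P Fin.rev (Equiv.refl _) Fin.rev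
    rw [h.inv_mul] at this
    exact this.trans (Matrix.submatrix_one _ Fin.rev_injective)
  mul_diagonal := by
    ext i j
    have := congrFun (congrFun h.mul_diagonal i) j.rev
    rw [Matrix.mul_diagonal] at this ⊢
    exact this
  diagonal_mul := by
    have := Matrix.submatrix_mul_equiv P B id Fin.revPerm Fin.rev
    ext i j
    refine Eq.trans ?_ (congrFun (congrFun this i) j).symm
    have := congrFun (congrFun h.diagonal_mul i) j.rev
    rw [Matrix.diagonal_mul] at this ⊢
    exact this

theorem rev_star (h : IsLeonardMatrices θ θs T B P Q) :
    IsLeonardMatrices θ (fun i => θs i.rev) (T.submatrix Fin.rev Fin.rev) B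
      (P.submatrix Fin.rev id) (Q.submatrix id Fin.rev) :=
  h.swap.rev.swap

/-- Row `j` of `Q` is a left eigenvector of `T`. As the subdiagonal of `T` has no zeros, each entry
of the row is determined by the preceding ones, so a zero first entry would make the whole row
vanish, against invertibility. -/
theorem inv_ne_zero (h : IsLeonardMatrices θ θs T B P Q) (j : Fin (d + 1)) : Q j 0 ≠ 0 := by
  intro h0
  have key : ∀ m : ℕ, ∀ k : Fin (d + 1), (k : ℕ) ≤ m → Q j k = 0 := by
    intro m
    induction m with
    | zero =>
      intro k hk
      obtain rfl : k = 0 := Fin.ext (by simpa using hk)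
      exact h0
    | succ m ih =>
      intro k hk
      by_cases hkm : (k : ℕ) ≤ m
      · exact ih k hkm
      have e := congrFun (congrFun h.swap.diagonal_mul j) ⟨m, by omega⟩
      rw [Matrix.diagonal_mul, ih _ le_rfl, mul_zero, Matrix.mul_apply,
        Finset.sum_eq_single k] at e
      · exact (mul_eq_zero.1 e.symm).resolve_right (h.irred.2 _ _ (by simp; omega))
      · intro l _ hl
        by_cases hlm : (l : ℕ) ≤ m
        · rw [ih l hlm, zero_mul]
        · have : (l : ℕ) ≠ k := fun h => hl (Fin.ext h)
          rw [h.irred.isLowerBand l _ (by simp; omega), mul_zero]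
      · simp
  have e := congrFun (congrFun h.inv_mul j) j
  rw [Matrix.mul_apply, Finset.sum_eq_zero, Matrix.one_apply_eq] at e
  · exact zero_ne_one e
  · intro k _
    rw [key d k (by omega), zero_mul]

theorem transition_ne_zero (h : IsLeonardMatrices θ θs T B P Q) (j : Fin (d + 1)) :
    P 0 j ≠ 0 :=
  h.transpose.inv_ne_zero j

theorem transition_last_ne_zero (h : IsLeonardMatrices θ θs T B P Q) (j : Fin (d + 1)) :
    P (Fin.last d) j ≠ 0 := by
  simpa using h.rev_star.transition_ne_zero j

theorem aeval_eq (h : IsLeonardMatrices θ θs T B P Q) (p : Polynomial F) :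
    Polynomial.aeval T p = P * Matrix.diagonal (fun i => p.eval (θ i)) * Q := by
  have hpow : ∀ k : ℕ, T ^ k = P * Matrix.diagonal (fun i => θ i ^ k) * Q := by
    intro k
    induction k with
    | zero => simp [h.mul_inv]
    | succ k ih =>
      rw [pow_succ', ih, ← mul_assoc, ← mul_assoc, h.mul_diagonal, mul_assoc P,
        Matrix.diagonal_mul_diagonal]
      simp only [pow_succ']
  induction p using Polynomial.induction_on' with
  | add p q hp hq =>
    rw [map_add, hp, hq, ← add_mul, ← mul_add, Matrix.diagonal_add]
    simp
  | monomial k a =>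
    rw [Polynomial.aeval_monomial, hpow, ← Algebra.smul_def, ← Matrix.smul_mul, ← Matrix.mul_smul]
    simp [← Matrix.diagonal_smul, Pi.smul_def]

theorem aeval_apply_zero (h : IsLeonardMatrices θ θs T B P Q) (p : Polynomial F)
    (i : Fin (d + 1)) :
    Polynomial.aeval T p i 0 = ∑ j, P i j * p.eval (θ j) * Q j 0 := by
  rw [h.aeval_eq, Matrix.mul_apply]
  simp only [Matrix.mul_diagonal]

theorem _root_.IsIrredTridiagonal.sum_mul_apply_zero (hd : 1 ≤ d) (hT : IsIrredTridiagonal T)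
    (g : Fin (d + 1) → F) :
    ∑ i, g i * T i 0 = g 0 * T 0 0 + g ⟨1, by omega⟩ * T ⟨1, by omega⟩ 0 := by
  refine Fintype.sum_eq_add _ _ (by simp [Fin.ext_iff]) fun i hi => ?_
  have h0 : (i : ℕ) ≠ 0 := fun h => hi.1 (Fin.ext h)
  have h1 : (i : ℕ) ≠ 1 := fun h => hi.2 (Fin.ext h)
  rw [hT.isLowerBand i 0 (by simp; omega), mul_zero]

/-- Either side is the first split parameter. -/
theorem first_relation (h : IsLeonardMatrices θ θs T B P Q) (hd : 1 ≤ d) :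
    (T 0 0 - θ 0) * (θs 0 - θs ⟨1, by omega⟩) = (B 0 0 - θs 0) * (θ 0 - θ ⟨1, by omega⟩) := by
  have e1 := congrFun (congrFun h.swap.diagonal_mul 0) 0
  rw [Matrix.diagonal_mul, Matrix.mul_apply, h.irred.sum_mul_apply_zero hd] at e1
  have hB := h.irred_star.transpose.sum_mul_apply_zero hd
  simp only [Matrix.transpose_apply] at hB
  have hsum : ∀ g : Fin (d + 1) → F, ∑ i, B 0 i * g i =
      B 0 0 * g 0 + B 0 ⟨1, by omega⟩ * g ⟨1, by omega⟩ := by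
    intro g
    simpa only [mul_comm] using hB g
  have e2 := congrFun (congrFun h.swap.mul_diagonal 0) 0
  rw [Matrix.mul_diagonal, Matrix.mul_apply, hsum] at e2
  -- Both sides are the corner entry of `B * Q * T`. Combined with `e1` and `e2` the off-diagonal
  -- terms cancel, leaving a multiple of `Q 0 0`.
  have e3 : (Q * Matrix.diagonal θs * T) 0 0 = (B * (Matrix.diagonal θ * Q)) 0 0 := by
    rw [← h.swap.mul_diagonal, mul_assoc, ← h.swap.diagonal_mul]
  rw [Matrix.mul_apply, Matrix.mul_apply] at e3
  simp only [Matrix.mul_diagonal, Matrix.diagonal_mul] at e3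
  rw [h.irred.sum_mul_apply_zero hd (fun i => Q 0 i * θs i), hsum] at e3
  refine mul_right_cancel₀ (h.inv_ne_zero 0) ?_
  linear_combination e3 + θs ⟨1, by omega⟩ * e1 + θ ⟨1, by omega⟩ * e2

/-- Equality would leave `B 0 1 * Q 1 0 = 0` in the corner of `B * Q = Q * diagonal θs`, but both
factors are nonzero. -/
theorem apply_zero_ne (h : IsLeonardMatrices θ θs T B P Q) (hd : 1 ≤ d) : B 0 0 ≠ θs 0 := by
  intro h0
  have hB := h.irred_star.transpose.sum_mul_apply_zero hd (fun i => Q i 0)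
  have e2 := congrFun (congrFun h.swap.mul_diagonal 0) 0
  rw [Matrix.mul_diagonal, Matrix.mul_apply] at e2
  simp only [Matrix.transpose_apply] at hB
  have e3 : B 0 ⟨1, by omega⟩ * Q ⟨1, by omega⟩ 0 = 0 := by
    simp only [mul_comm (B 0 _)] at e2 ⊢
    rw [hB, h0] at e2
    linear_combination e2
  exact mul_ne_zero (h.irred_star.2 _ _ (by simp)) (h.inv_ne_zero _) e3

end IsLeonardMatrices

/-- The product of the factors `X - t_h` for `h < k`. -/
noncomputable def initialProd (t : Fin (d + 1) → F) (k : ℕ) : Polynomial F :=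
  ∏ h ∈ Finset.univ.filter (fun h : Fin (d + 1) => (h : ℕ) < k),
    (Polynomial.X - Polynomial.C (t h))

theorem initialProd_zero (t : Fin (d + 1) → F) : initialProd t 0 = 1 := by
  simp [initialProd]

theorem initialProd_succ (t : Fin (d + 1) → F) (k : Fin (d + 1)) :
    initialProd t (k + 1) = initialProd t k * (Polynomial.X - Polynomial.C (t k)) := by
  unfold initialProd
  have : Finset.univ.filter (fun h : Fin (d + 1) => (h : ℕ) < k + 1) =
      insert k (Finset.univ.filter (fun h : Fin (d + 1) => (h : ℕ) < k)) := by
    ext x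
    simp only [Finset.mem_filter, Finset.mem_univ, true_and, Finset.mem_insert, Fin.ext_iff]
    omega
  rw [this, Finset.prod_insert (by simp), mul_comm]

theorem natDegree_initialProd_le (t : Fin (d + 1) → F) (k : ℕ) (hk : k ≤ d + 1) :
    (initialProd t k).natDegree ≤ k := by
  induction k with
  | zero => simp [initialProd_zero]
  | succ k ih =>
    rw [initialProd_succ t ⟨k, by omega⟩]
    refine Polynomial.natDegree_mul_le.trans ?_
    rw [Polynomial.natDegree_X_sub_C]
    exact Nat.add_le_add_right (ih (by omega)) 1

theorem eval_initialProd_eq_zero (t : Fin (d + 1) → F) {k : ℕ} {j : Fin (d + 1)} (hj : (j : ℕ) < k) :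
    (initialProd t k).eval (t j) = 0 := by
  rw [initialProd, Polynomial.eval_prod]
  exact Finset.prod_eq_zero (i := j) (by simpa using hj) (by simp)

theorem eval_initialProd_ne_zero {t : Fin (d + 1) → F} (ht : Function.Injective t) {k : ℕ}
    {j : Fin (d + 1)} (hj : k ≤ j) : (initialProd t k).eval (t j) ≠ 0 := by
  rw [initialProd, Polynomial.eval_prod]
  refine Finset.prod_ne_zero_iff.2 fun h hh => ?_
  simp only [Finset.mem_filter, Finset.mem_univ, true_and] at hh
  simp only [Polynomial.eval_sub, Polynomial.eval_X, Polynomial.eval_C]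
  exact sub_ne_zero.2 (ht.ne (by rintro rfl; omega))

theorem aeval_initialProd_one (T : Matrix (Fin (d + 1)) (Fin (d + 1)) F) (t : Fin (d + 1) → F) :
    Polynomial.aeval T (initialProd t 1) 0 0 = T 0 0 - t 0 := by
  have := initialProd_succ t 0
  rw [Fin.val_zero, initialProd_zero, one_mul, Nat.zero_add] at this
  rw [this]
  simp [Matrix.algebraMap_matrix_apply]

namespace IsLeonardMatrices

variable {θ θs : Fin (d + 1) → F} {T B P Q : Matrix (Fin (d + 1)) (Fin (d + 1)) F}

/-- The product of the first `d - 1` factors kills all eigencomponents but the last two. Its `(d,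
0)` entry vanishes by degree, which fixes the ratio of these two; the last column of `diagonal θs *
P = P * B` turns this into a formula in the last diagonal entry of `B`. -/
theorem last_split (h : IsLeonardMatrices θ θs T B P Q) (hd : 1 ≤ d) :
    (θs 0 - θs (Fin.last d)) * (Polynomial.aeval T (initialProd θ d) 0 0 /
        Polynomial.aeval T (initialProd θ (d - 1)) 0 0) =
      (B (Fin.last d) (Fin.last d) - θs (Fin.last d)) *
        (θ (Fin.last d) - θ ⟨d - 1, by omega⟩) := by
  obtain ⟨e, rfl⟩ : ∃ e, d = e + 1 := ⟨d - 1, by omega⟩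
  set l := Fin.last (e + 1) with hl
  set m : Fin (e + 1 + 1) := ⟨e, by omega⟩ with hm
  have hlm : m ≠ l := by simp [hl, hm, Fin.ext_iff]
  have hlt : ∀ j : Fin (e + 1 + 1), j ≠ m ∧ j ≠ l → (j : ℕ) < e := by
    intro j hj
    have h1 : (j : ℕ) ≠ e := fun h => hj.1 (Fin.ext h)
    have h2 : (j : ℕ) ≠ e + 1 := fun h => hj.2 (Fin.ext h)
    omega
  have hf : ∀ i, Polynomial.aeval T (initialProd θ e) i 0 =
      P i m * (initialProd θ e).eval (θ m) * Q m 0 +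
        P i l * (initialProd θ e).eval (θ l) * Q l 0 := by
    intro i
    rw [h.aeval_apply_zero]
    refine Fintype.sum_eq_add _ _ hlm fun j hj => ?_
    rw [eval_initialProd_eq_zero θ (hlt j hj), mul_zero, zero_mul]
  have hf' : Polynomial.aeval T (initialProd θ (e + 1)) 0 0 =
      P 0 l * ((initialProd θ e).eval (θ l) * (θ l - θ m)) * Q l 0 := by
    rw [h.aeval_apply_zero, Finset.sum_eq_single l]
    · have := initialProd_succ θ m
      rw [show (m : ℕ) = e from rfl] at this
      rw [this]
      simp
    · intro j _ hj
      have h2 : (j : ℕ) ≠ e + 1 := fun h => hj (Fin.ext h)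
      rw [eval_initialProd_eq_zero θ (by omega), mul_zero, zero_mul]
    · simp
  have hcol : ∀ i, θs i * P i l = P i m * B m l + P i l * B l l := by
    intro i
    rw [← Matrix.diagonal_mul, h.diagonal_mul, Matrix.mul_apply]
    refine Fintype.sum_eq_add _ _ hlm fun j hj => ?_
    have h1 : B j l = 0 := by
      by_contra h0
      have h1 := h.irred_star.1 _ _ h0
      have h2 := hlt j hj
      rw [hl, Fin.val_last] at h1
      omega
    rw [h1, mul_zero]
  have hband : Polynomial.aeval T (initialProd θ e) l 0 = 0 :=
    h.irred.isLowerBand.aeval_band (natDegree_initialProd_le θ e (by omega)) l 0 (by simp [hl])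
  have hl0 := hf l
  rw [hband] at hl0
  have c0 := hcol 0
  have cl := hcol l
  have hb : B m l ≠ 0 := h.irred_star.2 _ _ (by simp [hl, hm])
  have hP0 : P 0 l ≠ 0 := h.transition_ne_zero l
  have hPl : P l l ≠ 0 := h.transition_last_ne_zero l
  have hQm : Q m 0 ≠ 0 := h.inv_ne_zero m
  have hev : (initialProd θ e).eval (θ m) ≠ 0 := eval_initialProd_ne_zero h.inj (by simp [hm])
  have hs : θs 0 - θs l ≠ 0 := sub_ne_zero.2 (h.inj_star.ne (by simp [hl, Fin.ext_iff]))
  set X := (initialProd θ e).eval (θ l) * Q l 0 with hX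
  set Y := (initialProd θ e).eval (θ m) * Q m 0 with hY
  have hY0 : Y ≠ 0 := mul_ne_zero hev hQm
  have hXY : B m l * X = (B l l - θs l) * Y := by
    refine mul_left_cancel₀ hPl ?_
    rw [hX, hY]
    linear_combination (-B m l) * hl0 + (initialProd θ e).eval (θ m) * Q m 0 * cl
  have hfe : B m l * Polynomial.aeval T (initialProd θ e) 0 0 = P 0 l * Y * (θs 0 - θs l) := by
    rw [hf 0]
    have := hXY
    rw [hX, hY] at this
    rw [hY]
    linear_combination P 0 l * this - (initialProd θ e).eval (θ m) * Q m 0 * c0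
  -- `hfe` also shows that the denominator of the split parameter is nonzero.
  have hne : Polynomial.aeval T (initialProd θ e) 0 0 ≠ 0 := by
    intro h0
    rw [h0, mul_zero] at hfe
    exact mul_ne_zero (mul_ne_zero hP0 hY0) hs hfe.symm
  simp only [Nat.add_sub_cancel]
  rw [mul_div_assoc', div_eq_iff hne, hf']
  refine mul_left_cancel₀ hb ?_
  rw [show P 0 l * ((initialProd θ e).eval (θ l) * (θ l - θ m)) * Q l 0 =
    P 0 l * X * (θ l - θ m) by rw [hX]; ring]
  linear_combination (θs 0 - θs l) * P 0 l * (θ l - θ m) * hXY -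
    (B l l - θs l) * (θ l - θ m) * hfe

end IsLeonardMatrices

end LeonardMatrices

/-! ### The recurrences and the Askey-Wilson relation -/

section AskeyWilson

/-- A finite sequence as a function on the natural numbers. -/
def natExt {α : Type*} {d : ℕ} (θ : Fin (d + 1) → α) (n : ℕ) : α := θ (Fin.ofNat (d + 1) n)

theorem natExt_eq {α : Type*} {d : ℕ} (θ : Fin (d + 1) → α) {n : ℕ} (h : n < d + 1) :
    natExt θ n = θ ⟨n, h⟩ :=
  congrArg θ (Fin.ext (Nat.mod_eq_of_lt h))

theorem natExt_val {α : Type*} {d : ℕ} (θ : Fin (d + 1) → α) (i : Fin (d + 1)) : natExt θ i = θ i :=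
  natExt_eq θ i.2

theorem natExt_ne {α : Type*} {d : ℕ} {θ : Fin (d + 1) → α} (h : Function.Injective θ) {i j : ℕ} (hi : i ≤ d)
    (hj : j ≤ d) (hij : i ≠ j) : natExt θ i ≠ natExt θ j := by
  rw [natExt_eq θ (by omega : i < d + 1), natExt_eq θ (by omega : j < d + 1)]
  exact h.ne (by simpa [Fin.ext_iff] using hij)

variable {F : Type*} [Field F] {d : ℕ}

theorem exists_polynomial_eval_eq {θ : Fin (d + 1) → F} (h : Function.Injective θ)
    (z : Fin (d + 1) → F) :
    ∃ p : Polynomial F, p.natDegree ≤ d ∧ ∀ i, p.eval (θ i) = z i := by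
  refine ⟨Lagrange.interpolate Finset.univ θ z, ?_, fun i =>
    Lagrange.eval_interpolate_at_node z h.injOn (Finset.mem_univ i)⟩
  rw [Polynomial.natDegree_le_iff_coeff_eq_zero]
  intro N hN
  refine Polynomial.coeff_eq_zero_of_degree_lt
    ((Lagrange.degree_interpolate_lt z h.injOn).trans_le ?_)
  rw [Finset.card_univ, Fintype.card_fin]
  exact_mod_cast hN

/-- Adjacent terms of `t` satisfy the quadratic relation of the Askey-Wilson relation. -/
def IsAdjacentQuadratic (d : ℕ) (β γ ρ : F) (t : ℕ → F) : Prop :=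
  ∀ n, n + 1 ≤ d →
    t n ^ 2 - β * t n * t (n + 1) + t (n + 1) ^ 2 - γ * (t n + t (n + 1)) - ρ = 0

namespace IsLeonardMatrices

variable {θ θs : Fin (d + 1) → F} {T B P Q : Matrix (Fin (d + 1)) (Fin (d + 1)) F}

theorem mul_right_cancel (h : IsLeonardMatrices θ θs T B P Q)
    {X Y : Matrix (Fin (d + 1)) (Fin (d + 1)) F} (hXY : X * P = Y * P) : X = Y := by
  have := congrArg (· * Q) hXY
  simpa only [mul_assoc, h.mul_inv, mul_one] using this

theorem aeval_mul (h : IsLeonardMatrices θ θs T B P Q) (p : Polynomial F) :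
    Polynomial.aeval T p * P = P * Matrix.diagonal (fun i => p.eval (θ i)) := by
  rw [h.aeval_eq, mul_assoc, h.inv_mul, mul_one]

theorem mul_mul (h : IsLeonardMatrices θ θs T B P Q)
    (M : Matrix (Fin (d + 1)) (Fin (d + 1)) F) :
    T * (P * M) = P * (Matrix.diagonal θ * M) := by
  rw [← mul_assoc, h.mul_diagonal, mul_assoc]

theorem diagonal_mul_mul (h : IsLeonardMatrices θ θs T B P Q)
    (M : Matrix (Fin (d + 1)) (Fin (d + 1)) F) :
    Matrix.diagonal θs * (P * M) = P * (B * M) := by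
  rw [← mul_assoc, h.diagonal_mul, mul_assoc]

/-- In the eigenbasis of `A` the identity compares `θ_i θ_j (θ_i - θ_j) B_ij` with `(p(θ_i) -
p(θ_j)) B_ij`. Since `B` is tridiagonal only adjacent `i, j` impose a condition, and interpolating
partial sums meets all of them. -/
theorem exists_commutator (h : IsLeonardMatrices θ θs T B P Q) :
    ∃ p : Polynomial F, p.natDegree ≤ d ∧
      (∀ n, n + 1 ≤ d → p.eval (natExt θ n) - p.eval (natExt θ (n + 1)) =
        natExt θ n * natExt θ (n + 1) * (natExt θ n - natExt θ (n + 1))) ∧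
      T * T * Matrix.diagonal θs * T - T * Matrix.diagonal θs * (T * T) =
        Polynomial.aeval T p * Matrix.diagonal θs - Matrix.diagonal θs * Polynomial.aeval T p := by
  set c : ℕ → F := fun k => natExt θ k * natExt θ (k + 1) * (natExt θ k - natExt θ (k + 1))
  obtain ⟨p, hp, hz⟩ := exists_polynomial_eval_eq h.inj
    (fun i => -∑ k ∈ Finset.range i, c k)
  have hstep : ∀ n, n + 1 ≤ d → p.eval (natExt θ n) - p.eval (natExt θ (n + 1)) = c n := by
    intro n hn
    rw [natExt_eq θ (by omega : n < d + 1), natExt_eq θ (by omega : n + 1 < d + 1), hz, hz,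
      Finset.sum_range_succ]
    ring
  refine ⟨p, hp, hstep, h.mul_right_cancel ?_⟩
  simp only [sub_mul, mul_assoc, h.mul_diagonal, h.mul_mul, h.diagonal_mul, h.diagonal_mul_mul,
    h.aeval_mul]
  have haev : ∀ M : Matrix (Fin (d + 1)) (Fin (d + 1)) F, Polynomial.aeval T p * (P * M) =
      P * (Matrix.diagonal (fun i => p.eval (θ i)) * M) := by
    intro M
    rw [← mul_assoc, h.aeval_mul, mul_assoc]
  rw [haev, ← mul_sub P, ← mul_sub P]
  congr 1
  ext i j
  simp only [Matrix.diagonal_mul_diagonal, Matrix.sub_apply, Matrix.diagonal_mul,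
    Matrix.mul_diagonal]
  by_cases hB : B i j = 0
  · simp [hB]
  rcases h.irred_star.1 i j hB with hij | hij | hij
  · obtain rfl := Fin.ext hij
    ring
  · have := hstep j (by omega)
    simp only [c, ← hij, natExt_val] at this
    linear_combination B i j * this
  · have := hstep i (by omega)
    simp only [c, ← hij, natExt_val] at this
    linear_combination (-B i j) * this

/-- In the eigenbasis of `A*` the left side of the commutator identity reaches only three places
below the diagonal, whereas a `p` of degree `r > 3` would give a nonzero entry at `(r, 0)`. The
third subdiagonal then relates the `θs`. -/
theorem exists_cubic (h : IsLeonardMatrices θ θs T B P Q) :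
    ∃ p : Polynomial F, p.natDegree ≤ 3 ∧
      (∀ n, n + 1 ≤ d → p.eval (natExt θ n) - p.eval (natExt θ (n + 1)) =
        natExt θ n * natExt θ (n + 1) * (natExt θ n - natExt θ (n + 1))) ∧
      (∀ n, n + 3 ≤ d → natExt θs (n + 1) - natExt θs (n + 2) =
        p.coeff 3 * (natExt θs n - natExt θs (n + 3))) := by
  obtain ⟨p, hp, hstep, hT⟩ := h.exists_commutator
  have hb := h.irred.isLowerBand
  have hD := isLowerBand_diagonal θs
  have hb1 := ((hb.mul hb).mul hD).mul hb
  have hb2 := (hb.mul hD).mul (hb.mul hb)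
  have hdeg : p.natDegree ≤ 3 := by
    by_contra! hlt
    have e := congrFun (congrFun hT ⟨p.natDegree, by omega⟩) 0
    rw [Matrix.sub_apply, Matrix.sub_apply, hb1 _ _ (by simpa using hlt),
      hb2 _ _ (by simpa using hlt), Matrix.mul_diagonal, Matrix.diagonal_mul,
      hb.aeval_apply le_rfl _ _ (by simp), sub_zero] at e
    have h1 := h.irred.pow_apply_ne_zero p.natDegree ⟨p.natDegree, by omega⟩ 0 (by simp)
    have h2 : θs 0 - θs ⟨p.natDegree, by omega⟩ ≠ 0 := by
      refine sub_ne_zero.2 (h.inj_star.ne ?_)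
      simp [Fin.ext_iff]
      omega
    have h3 : p.coeff p.natDegree ≠ 0 := by
      rw [Polynomial.coeff_natDegree]
      refine Polynomial.leadingCoeff_ne_zero.2 ?_
      rintro rfl
      simp at hlt
    refine mul_ne_zero (mul_ne_zero h3 h1) h2 ?_
    linear_combination -e
  refine ⟨p, hdeg, hstep, fun n hn => ?_⟩
  set i0 : Fin (d + 1) := ⟨n, by omega⟩ with hi0
  set i1 : Fin (d + 1) := ⟨n + 1, by omega⟩ with hi1
  set i2 : Fin (d + 1) := ⟨n + 2, by omega⟩ with hi2
  set i3 : Fin (d + 1) := ⟨n + 3, by omega⟩ with hi3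
  rw [natExt_eq θs (by omega : n < d + 1), natExt_eq θs (by omega : n + 1 < d + 1),
    natExt_eq θs (by omega : n + 2 < d + 1), natExt_eq θs (by omega : n + 3 < d + 1)]
  have hcube : (T ^ 3) i3 i0 = T i3 i2 * T i2 i1 * T i1 i0 := by
    rw [pow_succ, pow_two, (hb.mul hb).mul_apply hb i3 i1 i0 rfl rfl,
      hb.mul_apply hb i3 i2 i1 rfl rfl]
  have e := congrFun (congrFun hT i3) i0
  rw [Matrix.sub_apply, Matrix.sub_apply, Matrix.mul_diagonal, Matrix.diagonal_mul,
    hb.aeval_apply hdeg i3 i0 rfl, hcube,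
    ((hb.mul hb).mul hD).mul_apply hb i3 i1 i0 rfl rfl, Matrix.mul_diagonal,
    (hb.mul hD).mul_apply (hb.mul hb) i3 i2 i0 rfl rfl, Matrix.mul_diagonal,
    hb.mul_apply hb i3 i2 i1 rfl rfl, hb.mul_apply hb i2 i1 i0 rfl rfl] at e
  have h1 : T i3 i2 * T i2 i1 * T i1 i0 ≠ 0 := by
    rw [← hcube]
    exact h.irred.pow_apply_ne_zero 3 i3 i0 rfl
  refine mul_left_cancel₀ h1 ?_
  linear_combination e

/-- Dividing `p(x) - p(y) = x y (x - y)`, for adjacent eigenvalues and a cubic `p`, by `x - y` and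
by the leading coefficient gives the symmetric quadratic relation, with `β + 1` the inverse of that
coefficient. -/
theorem exists_recurrence (h : IsLeonardMatrices θ θs T B P Q) (hd : 3 ≤ d) :
    ∃ β γ γs ρ : F, IsThreeTerm d β γ (natExt θ) ∧ IsThreeTerm d β γs (natExt θs) ∧
      IsAdjacentQuadratic d β γ ρ (natExt θ) := by
  obtain ⟨p, hdeg, hstep, hstar⟩ := h.exists_cubic
  have hc : p.coeff 3 ≠ 0 := by
    intro h0
    have := hstar 0 (by omega)
    rw [h0, zero_mul, sub_eq_zero] at this
    exact natExt_ne h.inj_star (by omega) (by omega) (by omega) this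
  have hev : ∀ x, p.eval x = p.coeff 0 + p.coeff 1 * x + p.coeff 2 * x ^ 2 + p.coeff 3 * x ^ 3 := by
    intro x
    rw [Polynomial.eval_eq_sum_range' (Nat.lt_succ_of_le hdeg)]
    simp [Finset.sum_range_succ]
  have hquad : IsAdjacentQuadratic d ((p.coeff 3)⁻¹ - 1) (-(p.coeff 2 / p.coeff 3))
      (-(p.coeff 1 / p.coeff 3)) (natExt θ) := by
    intro n hn
    have e := hstep n hn
    rw [hev, hev] at e
    have hne := sub_ne_zero.2 (natExt_ne h.inj (by omega) hn (by omega) :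
      natExt θ n ≠ natExt θ (n + 1))
    refine mul_left_cancel₀ (mul_ne_zero hc hne) ?_
    linear_combination e + (natExt θ n - natExt θ (n + 1)) *
      (p.coeff 2 * (natExt θ n + natExt θ (n + 1)) + p.coeff 1 -
        natExt θ n * natExt θ (n + 1)) * mul_inv_cancel₀ hc
  -- The dual constant is chosen to make the recurrence hold at `0`; the cubic relation propagates
  -- it.
  refine ⟨_, _, natExt θs 0 + natExt θs 2 - ((p.coeff 3)⁻¹ - 1) * natExt θs 1, _, ?_, ?_, hquad⟩
  -- Two consecutive quadratic relations differ by `θ_n - θ_{n+2}` times the three-term recurrence.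
  · intro n hn
    have e1 := hquad n (by omega)
    have e2 := hquad (n + 1) (by omega)
    have hne := sub_ne_zero.2 (natExt_ne h.inj (by omega) hn (by omega) :
      natExt θ n ≠ natExt θ (n + 2))
    refine mul_left_cancel₀ hne ?_
    linear_combination e1 - e2
  · intro n
    induction n with
    | zero => intro _; ring
    | succ n ih =>
      intro hn
      have e1 := ih (by omega)
      have e2 := hstar n (by omega)
      have e3 : natExt θs n - natExt θs (n + 3) =
          (p.coeff 3)⁻¹ * (natExt θs (n + 1) - natExt θs (n + 2)) := by
        rw [e2, inv_mul_cancel_left₀ hc]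
      rw [show n + 1 + 2 = n + 3 from rfl, show n + 1 + 1 = n + 2 from rfl]
      linear_combination e1 - e3

/-- The diagonal entries, in either eigenbasis, of the Askey-Wilson relation. -/
theorem exists_askeyWilson (h : IsLeonardMatrices θ θs T B P Q) (hd : 3 ≤ d) {β γ γs ρ : F}
    (hstar : IsThreeTerm d β γs (natExt θs)) (hquad : IsAdjacentQuadratic d β γ ρ (natExt θ)) :
    ∃ ω η : F,
      (∀ i, B i i * ((2 - β) * θ i ^ 2 - 2 * γ * θ i - ρ) = γs * θ i ^ 2 + ω * θ i + η) ∧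
      ∀ i, ∑ k, T i k * T k i * (2 * θs i - β * θs k - γs) =
        (2 * γ * θs i + ω) * T i i + ρ * θs i + η := by
  obtain ⟨f, hf, hz⟩ := exists_polynomial_eval_eq h.inj
    (fun i => B i i * ((2 - β) * θ i ^ 2 - 2 * γ * θ i - ρ))
  set D := Matrix.diagonal θs with hDdef
  -- In the eigenbasis of `A`, off-diagonal entries of the left side vanish by `hquad` and the
  -- tridiagonal shape; `f` interpolates the diagonal.
  have hrel : T * T * D - β • (T * D * T) + D * (T * T) - γ • (T * D + D * T) - ρ • D =
      Polynomial.aeval T f := by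
    refine h.mul_right_cancel ?_
    simp only [hDdef, sub_mul, add_mul, Matrix.smul_mul, mul_assoc, h.mul_diagonal, h.mul_mul,
      h.diagonal_mul, h.diagonal_mul_mul, h.aeval_mul, ← Matrix.mul_smul, ← mul_add, ← mul_sub]
    congr 1
    simp only [Matrix.mul_smul]
    ext i j
    simp only [Matrix.sub_apply, Matrix.add_apply, Matrix.smul_apply, smul_eq_mul,
      Matrix.diagonal_mul, Matrix.mul_diagonal, ← mul_assoc]
    by_cases hij : i = j
    · obtain rfl := hij
      rw [Matrix.diagonal_apply_eq, hz]
      ring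
    rw [Matrix.diagonal_apply_ne _ hij]
    by_cases hB : B i j = 0
    · simp [hB]
    rcases h.irred_star.1 i j hB with hij' | hij' | hij'
    · exact absurd (Fin.ext hij') hij
    · have := hquad j (by omega)
      simp only [← hij', natExt_val] at this
      linear_combination B i j * this
    · have := hquad i (by omega)
      simp only [← hij', natExt_val] at this
      linear_combination B i j * this
  have hb := h.irred.isLowerBand
  have hD : IsLowerBand 0 D := isLowerBand_diagonal θs
  have hentry : ∀ i j, Polynomial.aeval T f i j = (T * T) i j * (θs j + θs i) -
      β * (T * D * T) i j - γ * (T i j * (θs j + θs i)) - ρ * D i j := by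
    intro i j
    rw [← hrel]
    simp only [hDdef, Matrix.sub_apply, Matrix.add_apply, Matrix.smul_apply, smul_eq_mul,
      Matrix.diagonal_mul, Matrix.mul_diagonal]
    ring
  -- The left side of `hrel` has lower band `2`, which bounds the degree of `f`.
  have hdeg : f.natDegree ≤ 2 := by
    by_contra! hlt
    have e := hentry ⟨f.natDegree, by omega⟩ 0
    rw [(hb.mul hb) _ _ (by simpa using hlt), ((hb.mul hD).mul hb) _ _ (by simpa using hlt),
      hb _ _ (by simp; omega), hD _ _ (by simp; omega),
      hb.aeval_apply le_rfl _ _ (by simp)] at e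
    have h1 := h.irred.pow_apply_ne_zero f.natDegree ⟨f.natDegree, by omega⟩ 0 (by simp)
    have h3 : f.coeff f.natDegree ≠ 0 := by
      rw [Polynomial.coeff_natDegree]
      refine Polynomial.leadingCoeff_ne_zero.2 ?_
      rintro rfl
      simp at hlt
    refine mul_ne_zero h3 h1 ?_
    linear_combination e
  -- At `(2, 0)` the relation reads `θs_0 - β θs_1 + θs_2`, which is `γs` by the recurrence.
  have hc : f.coeff 2 = γs := by
    set i1 : Fin (d + 1) := ⟨1, by omega⟩ with hi1
    set i2 : Fin (d + 1) := ⟨2, by omega⟩ with hi2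
    have e := hentry i2 0
    have hs := hstar 0 (by omega)
    rw [natExt_eq θs (by omega : 0 < d + 1), natExt_eq θs (by omega : 0 + 1 < d + 1),
      natExt_eq θs (by omega : 0 + 2 < d + 1)] at hs
    replace hs : θs 0 + θs i2 = β * θs i1 + γs := hs
    rw [hb.aeval_apply hdeg i2 0 (by simp [hi2]), pow_two,
      hb.mul_apply hb i2 i1 0 (by simp [hi1]) rfl,
      (hb.mul hD).mul_apply hb i2 i1 0 (by simp [hi1]) rfl, hDdef, Matrix.mul_diagonal,
      hb i2 0 (by simp [hi2]), Matrix.diagonal_apply_ne _ (by simp [hi2, Fin.ext_iff])] at e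
    have h1 : T i2 i1 * T i1 0 ≠ 0 :=
      mul_ne_zero (h.irred.2 _ _ (by simp [hi1, hi2])) (h.irred.2 _ _ (by simp [hi1]))
    refine mul_right_cancel₀ h1 ?_
    linear_combination e + T i2 i1 * T i1 0 * hs
  have hev : ∀ x, f.eval x = f.coeff 0 + f.coeff 1 * x + f.coeff 2 * x ^ 2 := by
    intro x
    rw [Polynomial.eval_eq_sum_range' (Nat.lt_succ_of_le hdeg)]
    simp [Finset.sum_range_succ]
  refine ⟨f.coeff 1, f.coeff 0, fun i => ?_, fun i => ?_⟩
  · rw [← hz i, hev, hc]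
    ring
  · have e := hentry i i
    have hfT : Polynomial.aeval T f i i = f.coeff 0 + f.coeff 1 * T i i + γs * (T * T) i i := by
      rw [Polynomial.aeval_eq_sum_range' (Nat.lt_succ_of_le hdeg), ← hc]
      simp [Finset.sum_range_succ, pow_two]
    rw [hfT, Matrix.mul_apply, Matrix.mul_apply, hDdef, Matrix.diagonal_apply_eq] at e
    simp only [Matrix.mul_diagonal] at e
    have hsum : ∑ k, T i k * T k i * (2 * θs i - β * θs k - γs) =
        (2 * θs i - γs) * ∑ k, T i k * T k i - β * ∑ k, T i k * θs k * T k i := by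
      rw [Finset.mul_sum, Finset.mul_sum, ← Finset.sum_sub_distrib]
      exact Finset.sum_congr rfl fun k _ => by ring
    rw [hsum]
    linear_combination -e

end IsLeonardMatrices

end AskeyWilson

/-! ### Recovering eigenvalues and matrix entries from the end data -/

section Uniqueness

variable {F : Type*} [Field F] {d : ℕ}

/-- Identifies `β` with the fundamental parameter. -/
theorem IsThreeTerm.sub_three {β γ : F} {t : ℕ → F} (h : IsThreeTerm d β γ t) (hd : 3 ≤ d) :
    t 0 - t 3 = (β + 1) * (t 1 - t 2) := by
  linear_combination h 0 (by omega) - h 1 (by omega)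

/-- The parameters of the Askey-Wilson relation are determined by its values at both ends. -/
theorem askeyWilson_ends {θ b b' : Fin (d + 1) → F} {β γ γs ρ ω η ω' η' : F} (hd : 1 ≤ d)
    (hθ : Function.Injective θ)
    (hb : ∀ i, b i * ((2 - β) * θ i ^ 2 - 2 * γ * θ i - ρ) = γs * θ i ^ 2 + ω * θ i + η)
    (hb' : ∀ i, b' i * ((2 - β) * θ i ^ 2 - 2 * γ * θ i - ρ) = γs * θ i ^ 2 + ω' * θ i + η')
    (h0 : b' 0 = b 0) (hl : b' (Fin.last d) = b (Fin.last d)) : ω' = ω ∧ η' = η := by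
  have e0 := hb' 0
  have el := hb' (Fin.last d)
  rw [h0, hb] at e0
  rw [hl, hb] at el
  have hne : θ 0 - θ (Fin.last d) ≠ 0 :=
    sub_ne_zero.2 (hθ.ne (by simp [Fin.ext_iff]; omega))
  have hω : ω' = ω := by
    refine mul_right_cancel₀ hne ?_
    linear_combination el - e0
  refine ⟨hω, ?_⟩
  rw [hω] at e0
  linear_combination -e0

/-- The ends fix `ω` and `η`; at an interior index the factor multiplying `b i` is nonzero and can
be divided out. -/
theorem askeyWilson_diag_eq {θ b b' : Fin (d + 1) → F} {β γ γs ρ ω η ω' η' : F} (hd : 1 ≤ d)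
    (hθ : Function.Injective θ) (hthree : IsThreeTerm d β γ (natExt θ))
    (hquad : IsAdjacentQuadratic d β γ ρ (natExt θ))
    (hb : ∀ i, b i * ((2 - β) * θ i ^ 2 - 2 * γ * θ i - ρ) = γs * θ i ^ 2 + ω * θ i + η)
    (hb' : ∀ i, b' i * ((2 - β) * θ i ^ 2 - 2 * γ * θ i - ρ) = γs * θ i ^ 2 + ω' * θ i + η')
    (h0 : b' 0 = b 0) (hl : b' (Fin.last d) = b (Fin.last d)) (i : Fin (d + 1)) :
    b' i = b i := by
  obtain ⟨rfl, rfl⟩ := askeyWilson_ends hd hθ hb hb' h0 hl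
  rcases Nat.eq_zero_or_pos (i : ℕ) with hi | hi
  · obtain rfl : i = 0 := Fin.ext hi
    exact h0
  by_cases hi' : (i : ℕ) = d
  · obtain rfl : i = Fin.last d := Fin.ext hi'
    exact hl
  obtain ⟨n, hn⟩ : ∃ n, (i : ℕ) = n + 1 := ⟨i - 1, by omega⟩
  have e1 := hthree n (by omega)
  have e2 := hquad (n + 1) (by omega)
  rw [← hn, natExt_val] at e1 e2
  have n1 := natExt_ne hθ (i := n) (j := n + 1) (by omega) (by omega) (by omega)
  have n2 := natExt_ne hθ (i := n + 2) (j := n + 1) (by omega) (by omega) (by omega)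
  rw [← hn, natExt_val] at n1 n2
  -- With one argument fixed at `θ i`, the adjacency quadratic has the two neighbours as roots; this
  -- is its value at `θ i`, factored.
  have hq : (2 - β) * θ i ^ 2 - 2 * γ * θ i - ρ =
      (natExt θ n - θ i) * (natExt θ (n + 2) - θ i) := by
    rw [hn] at e2
    linear_combination e2 - natExt θ (n + 2) * e1 + θ i * e1
  refine mul_right_cancel₀ (mul_ne_zero (sub_ne_zero.2 n1) (sub_ne_zero.2 n2)) ?_
  rw [← hq, hb, hb']

namespace IsLeonardMatrices

variable {θ θs θ' θs' : Fin (d + 1) → F} {T B P Q T' B' P' Q' : Matrix (Fin (d + 1)) (Fin (d + 1)) F}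

/-- The relations from both sides share constants, since each recurrence for `θs` determines its `β`
and then its `γs`. -/
theorem exists_recurrences (h : IsLeonardMatrices θ θs T B P Q) (hd : 3 ≤ d) :
    ∃ β γ γs ρ ρs : F, IsThreeTerm d β γ (natExt θ) ∧ IsThreeTerm d β γs (natExt θs) ∧
      IsAdjacentQuadratic d β γ ρ (natExt θ) ∧ IsAdjacentQuadratic d β γs ρs (natExt θs) := by
  obtain ⟨β, γ, γs, ρ, h1, h2, h3⟩ := h.exists_recurrence hd
  obtain ⟨β', γs', γ', ρs, h1', h2', h3'⟩ := h.swap.exists_recurrence hd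
  have hβ : β' = β := by
    have e1 := h2.sub_three hd
    have e2 := h1'.sub_three hd
    have hne := sub_ne_zero.2 (natExt_ne h.inj_star (i := 1) (j := 2) (by omega) (by omega)
      (by omega))
    refine mul_right_cancel₀ hne ?_
    linear_combination e1 - e2
  subst hβ
  have hγ : γs' = γs := by
    linear_combination h2 0 (by omega) - h1' 0 (by omega)
  subst hγ
  exact ⟨_, _, _, _, _, h1, h2, h3, h3'⟩

/-- The eigenvalues and the end entries of the two diagonals determine the diagonal of `T` and the
products of its opposite off-diagonal entries. -/
theorem mul_eq_of_ends (h : IsLeonardMatrices θ θs T B P Q)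
    (h' : IsLeonardMatrices θ θs T' B' P' Q') (hd : 3 ≤ d) (hT0 : T' 0 0 = T 0 0)
    (hTl : T' (Fin.last d) (Fin.last d) = T (Fin.last d) (Fin.last d)) (hB0 : B' 0 0 = B 0 0)
    (hBl : B' (Fin.last d) (Fin.last d) = B (Fin.last d) (Fin.last d)) :
    (∀ i, T' i i = T i i) ∧ ∀ i j, T' i j * T' j i = T i j * T j i := by
  obtain ⟨β, γ, γs, ρ, ρs, hθ, hθs, hquad, hquads⟩ := h.exists_recurrences hd
  obtain ⟨ω, η, hB, hT⟩ := h.exists_askeyWilson hd hθs hquad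
  -- The constants `β, γ, γs, ρ` concern only the common eigenvalues, so they serve both systems.
  obtain ⟨ω', η', hB', hT'⟩ := h'.exists_askeyWilson hd hθs hquad
  obtain ⟨rfl, rfl⟩ := askeyWilson_ends (by omega) h.inj hB hB' hB0 hBl
  obtain ⟨ωs, ηs, hTs, -⟩ := h.swap.exists_askeyWilson hd hθ hquads
  obtain ⟨ωs', ηs', hTs', -⟩ := h'.swap.exists_askeyWilson hd hθ hquads
  have hdiag : ∀ i, T' i i = T i i :=
    askeyWilson_diag_eq (by omega) h.inj_star hθs hquads hTs hTs' hT0 hTl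
  refine ⟨hdiag, ?_⟩
  set D : Fin (d + 1) → Fin (d + 1) → F := fun i k => T' i k * T' k i - T i k * T k i with hD
  have hsymm : ∀ i k, D i k = D k i := fun i k => by simp only [hD]; ring
  have hD0 : ∀ i, D i i = 0 := fun i => by simp only [hD, hdiag, sub_self]
  have hfar : ∀ i k : Fin (d + 1), (i : ℕ) + 1 < k → D i k = 0 := by
    intro i k hik
    simp only [hD]
    rw [h.irred.isLowerBand k i hik, h'.irred.isLowerBand k i hik]
    ring
  have hsum : ∀ i, ∑ k, D i k * (2 * θs i - β * θs k - γs) = 0 := by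
    intro i
    simp only [hD, sub_mul, Finset.sum_sub_distrib] at hT hT' ⊢
    rw [hT, hT', hdiag, sub_self]
  -- Row `i` of `hsum` gives the product at `(i, i + 1)` from the previous one: by the recurrence
  -- its coefficient is `θs_i - θs_{i+2}`.
  have hstep : ∀ n, ∀ hn : n + 1 ≤ d,
      D ⟨n, by omega⟩ ⟨n + 1, by omega⟩ = 0 := by
    intro n
    induction n with
    | zero =>
      intro hn
      have e := hsum 0
      rw [Finset.sum_eq_single ⟨1, by omega⟩] at e
      · refine (mul_eq_zero.1 e).resolve_right ?_
        have h2 := hθs 0 (by omega)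
        have h3 := natExt_ne h.inj_star (i := 0) (j := 2) (by omega) (by omega) (by omega)
        rw [natExt_eq θs (by omega : 0 < d + 1), natExt_eq θs (by omega : 0 + 1 < d + 1)] at h2
        rw [natExt_eq θs (by omega : 0 < d + 1)] at h3
        intro h4
        refine h3 ?_
        simp only [Nat.zero_add, Fin.zero_eta] at h2 h3 ⊢
        linear_combination h4 - h2
      · intro k _ hk
        by_cases hk0 : k = 0
        · rw [hk0, hD0, zero_mul]
        · rw [hfar 0 k, zero_mul]
          have h1 : (k : ℕ) ≠ 0 := fun h => hk0 (Fin.ext h)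
          have h2 : (k : ℕ) ≠ 1 := fun h => hk (Fin.ext h)
          simp only [Fin.val_zero]
          omega
      · simp
    | succ n ih =>
      intro hn
      by_cases hnd : n + 2 = d
      -- The last product has no `θs_{i+2}`; row `d` is used instead, with coefficient `θs_d -
      -- θs_{d-2}`.
      · have e := hsum ⟨n + 2, by omega⟩
        rw [Finset.sum_eq_single ⟨n + 1, by omega⟩] at e
        · rw [hsymm]
          refine (mul_eq_zero.1 e).resolve_right ?_
          have h2 := hθs n (by omega)
          have h3 := natExt_ne h.inj_star (i := n) (j := n + 2) (by omega) (by omega) (by omega)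
          rw [natExt_eq θs (by omega : n + 2 < d + 1)] at h2 h3
          rw [natExt_eq θs (by omega : n + 1 < d + 1)] at h2
          intro h4
          refine h3 ?_
          linear_combination h2 - h4
        · intro k _ hk
          have h1 : (k : ℕ) ≠ n + 1 := fun h => hk (Fin.ext h)
          by_cases hk0 : (k : ℕ) = n + 2
          · rw [show k = ⟨n + 2, by omega⟩ from Fin.ext hk0, hD0, zero_mul]
          · rw [hsymm, hfar k _ (by simp; omega), zero_mul]
        · simp
      · have e := hsum ⟨n + 1, by omega⟩
        rw [Finset.sum_eq_single ⟨n + 2, by omega⟩] at e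
        · refine (mul_eq_zero.1 e).resolve_right ?_
          have h2 := hθs (n + 1) (by omega)
          have h3 := natExt_ne h.inj_star (i := n + 1) (j := n + 3) (by omega) (by omega)
            (by omega)
          rw [natExt_eq θs (by omega : n + 1 < d + 1)] at h2 h3
          rw [natExt_eq θs (by omega : n + 1 + 1 < d + 1)] at h2
          intro h4
          refine h3 ?_
          rw [show n + 1 + 2 = n + 3 from rfl] at h2
          linear_combination h4 - h2
        · intro k _ hk
          have h1 : (k : ℕ) ≠ n + 2 := fun h => hk (Fin.ext h)
          by_cases hk1 : (k : ℕ) = n + 1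
          · rw [show k = ⟨n + 1, by omega⟩ from Fin.ext hk1, hD0, zero_mul]
          by_cases hk0 : (k : ℕ) = n
          · rw [show k = ⟨n, by omega⟩ from Fin.ext hk0, hsymm, ih (by omega), zero_mul]
          by_cases hkn : (k : ℕ) < n
          · rw [hsymm, hfar k _ (by simp; omega), zero_mul]
          · rw [hfar _ k (by simp; omega), zero_mul]
        · simp
  have hlt : ∀ i j : Fin (d + 1), i < j → D i j = 0 := by
    intro i j hij
    by_cases hj : (j : ℕ) = i + 1
    · have := hstep i (by omega)
      rwa [show (⟨(i : ℕ) + 1, by omega⟩ : Fin (d + 1)) = j from Fin.ext hj.symm] at this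
    · exact hfar i j (by have := Fin.lt_def.1 hij; omega)
  intro i j
  refine sub_eq_zero.1 (show D i j = 0 from ?_)
  rcases lt_trichotomy i j with hij | rfl | hij
  · exact hlt i j hij
  · exact hD0 i
  · rw [hsymm]
    exact hlt j i hij

theorem rev_one (hd : 1 ≤ d) :
    (⟨1, by omega⟩ : Fin (d + 1)).rev = ⟨d - 1, by omega⟩ :=
  Fin.ext (by simp [Fin.val_rev])

/-- The end entries and the fundamental parameter determine the eigenvalues, unless
`θs_0 - θs_1 = θs_d - θs_{d-1}`. -/
theorem eigenvalues_eq (h : IsLeonardMatrices θ θs T B P Q)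
    (h' : IsLeonardMatrices θ' θs' T' B' P' Q') (hd : 3 ≤ d)
    (hne : θs 0 - θs ⟨1, by omega⟩ ≠ θs (Fin.last d) - θs ⟨d - 1, by omega⟩)
    (hβ : (natExt θ' 0 - natExt θ' 3) / (natExt θ' 1 - natExt θ' 2) =
      (natExt θ 0 - natExt θ 3) / (natExt θ 1 - natExt θ 2))
    (hθ0 : θ' 0 = θ 0) (hθl : θ' (Fin.last d) = θ (Fin.last d))
    (hθs0 : θs' 0 = θs 0) (hθsl : θs' (Fin.last d) = θs (Fin.last d))
    (hT0 : T' 0 0 = T 0 0)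
    (hTl : T' (Fin.last d) (Fin.last d) = T (Fin.last d) (Fin.last d)) (hB0 : B' 0 0 = B 0 0)
    (hBl : B' (Fin.last d) (Fin.last d) = B (Fin.last d) (Fin.last d)) :
    θ' = θ ∧ θs' = θs := by
  have hd1 : 1 ≤ d := by omega
  obtain ⟨β, γ, γs, -, -, r, rs, -, -⟩ := h.exists_recurrences hd
  obtain ⟨β', γ', γs', -, -, r', rs', -, -⟩ := h'.exists_recurrences hd
  have hββ : β' = β := by
    have n1 := sub_ne_zero.2 (natExt_ne h.inj (i := 1) (j := 2) (by omega) (by omega) (by omega))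
    have n2 := sub_ne_zero.2 (natExt_ne h'.inj (i := 1) (j := 2) (by omega) (by omega) (by omega))
    rw [r.sub_three hd, r'.sub_three hd, mul_div_cancel_right₀ _ n1,
      mul_div_cancel_right₀ _ n2] at hβ
    exact add_right_cancel hβ
  subst hββ
  have z0 : ∀ t : Fin (d + 1) → F, natExt t 0 = t 0 := fun t => natExt_eq t (by omega)
  have z1 : ∀ t : Fin (d + 1) → F, natExt t 1 = t ⟨1, by omega⟩ := fun t => natExt_eq t _
  have zm : ∀ t : Fin (d + 1) → F, natExt t (d - 1) = t ⟨d - 1, by omega⟩ :=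
    fun t => natExt_eq t _
  have zl : ∀ t : Fin (d + 1) → F, natExt t d = t (Fin.last d) := fun t => natExt_eq t _
  have s1 := h.first_relation hd1
  have s1' := h'.first_relation hd1
  have s2 := h.rev.first_relation hd1
  have s2' := h'.rev.first_relation hd1
  have s3 := h.rev.rev_star.first_relation hd1
  have s3' := h'.rev.rev_star.first_relation hd1
  have c1 := sub_ne_zero.2 (h.apply_zero_ne hd1)
  have c2 := sub_ne_zero.2 (h.rev.apply_zero_ne hd1)
  have c3 := sub_ne_zero.2 (h.rev.rev_star.apply_zero_ne hd1)
  simp only [Matrix.submatrix_apply, Fin.rev_zero, rev_one hd1] at s1 s1' s2 s2' s3 s3' c1 c2 c3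
  have hs := rs.sub_mul_sub rs' (by omega)
  simp only [z0, z1, zm, zl] at hs
  rw [hθ0, hθs0, hT0, hB0] at s1'
  rw [hθs0, hθl, hT0, hBl] at s2'
  rw [hθl, hθsl, hTl, hBl] at s3'
  rw [hθs0, hθsl] at hs
  have hxne : θs 0 - θs (Fin.last d) ≠ 0 :=
    sub_ne_zero.2 (h.inj_star.ne (by simp [Fin.ext_iff]; omega))
  have hyne : θ (Fin.last d) - θ ⟨d - 1, by omega⟩ ≠ 0 :=
    sub_ne_zero.2 (h.inj.ne (by simp [Fin.ext_iff]; omega))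
  -- The difference of the entries of `θs` at `1` and `d - 1` is the same in both systems.
  have hδ := mul_right_cancel₀ hxne hs
  have k2 := (mul_ne_zero_iff.1 (s2.trans_ne (mul_ne_zero c2 hyne))).1
  have k3 := (mul_ne_zero_iff.1 (s3.trans_ne (mul_ne_zero c3 hyne))).1
  -- `s2` and `s3` share the factor `θ_d - θ_{d-1}`; eliminating it shows that the ratio of the two
  -- end gaps of `θs` agrees in both systems.
  have hprop : (θs 0 - θs' ⟨1, by omega⟩) * (θs (Fin.last d) - θs ⟨d - 1, by omega⟩) =
      (θs 0 - θs ⟨1, by omega⟩) * (θs (Fin.last d) - θs' ⟨d - 1, by omega⟩) := by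
    refine mul_left_cancel₀ (mul_ne_zero k2 k3) ?_
    linear_combination ((T (Fin.last d) (Fin.last d) - θ (Fin.last d)) *
      (θs (Fin.last d) - θs ⟨d - 1, by omega⟩)) * s2' +
      ((B (Fin.last d) (Fin.last d) - θs 0) * (θ (Fin.last d) - θ' ⟨d - 1, by omega⟩)) * s3 -
      ((T (Fin.last d) (Fin.last d) - θ (Fin.last d)) *
      (θs (Fin.last d) - θs' ⟨d - 1, by omega⟩)) * s2 -
      ((B (Fin.last d) (Fin.last d) - θs 0) * (θ (Fin.last d) - θ ⟨d - 1, by omega⟩)) * s3'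
  have hs1 : θs' ⟨1, by omega⟩ = θs ⟨1, by omega⟩ := by
    refine mul_right_cancel₀ (sub_ne_zero.2 hne) ?_
    linear_combination hprop - (θs 0 - θs ⟨1, by omega⟩) * hδ
  have h1 : θ' ⟨1, by omega⟩ = θ ⟨1, by omega⟩ := by
    refine mul_left_cancel₀ c1 ?_
    rw [hs1] at s1'
    linear_combination s1' - s1
  constructor
  · funext i
    have := r.eq_of_ends r' (fun i j hij hj => natExt_ne h.inj (by omega) hj (by omega))
      (by omega) (by rw [z0, z0, hθ0]) (by rw [z1, z1, h1]) (by rw [zl, zl, hθl]) i (by omega)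
    simpa only [natExt_val] using this
  · funext i
    have := rs.eq_of_ends rs' (fun i j hij hj => natExt_ne h.inj_star (by omega) hj (by omega))
      (by omega) (by rw [z0, z0, hθs0]) (by rw [z1, z1, hs1]) (by rw [zl, zl, hθsl]) i (by omega)
    simpa only [natExt_val] using this

end IsLeonardMatrices

/-- Partial products of the ratios of subdiagonal entries match the subdiagonals; equality of
opposite products then matches the superdiagonals. -/
theorem IsIrredTridiagonal.exists_scaling {T T' : Matrix (Fin (d + 1)) (Fin (d + 1)) F}
    (hT : IsIrredTridiagonal T) (hT' : IsIrredTridiagonal T') (hdiag : ∀ i, T' i i = T i i)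
    (hmul : ∀ i j, T' i j * T' j i = T i j * T j i) :
    ∃ s : Fin (d + 1) → F, (∀ i, s i ≠ 0) ∧ ∀ i j, s i * T' i j = s j * T i j := by
  set r : ℕ → F := fun k => if h : k + 1 < d + 1 then
    T ⟨k + 1, h⟩ ⟨k, by omega⟩ / T' ⟨k + 1, h⟩ ⟨k, by omega⟩ else 1 with hr
  have hr0 : ∀ k, r k ≠ 0 := by
    intro k
    simp only [hr]
    split_ifs with h
    · exact div_ne_zero (hT.2 _ _ (by simp)) (hT'.2 _ _ (by simp))
    · exact one_ne_zero
  have hs0 : ∀ i : Fin (d + 1), ∏ k ∈ Finset.range i, r k ≠ 0 :=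
    fun i => Finset.prod_ne_zero_iff.2 fun k _ => hr0 k
  refine ⟨fun i => ∏ k ∈ Finset.range i, r k, hs0, ?_⟩
  have hlow : ∀ i j : Fin (d + 1), (i : ℕ) = j + 1 →
      (∏ k ∈ Finset.range i, r k) * T' i j = (∏ k ∈ Finset.range j, r k) * T i j := by
    intro i j hij
    have hT'0 : T' i j ≠ 0 := hT'.2 i j (by omega)
    have hrj : r j = T i j / T' i j := by
      simp only [hr]
      rw [dif_pos (by omega)]
      rw [show (⟨(j : ℕ) + 1, by omega⟩ : Fin (d + 1)) = i from Fin.ext hij.symm]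
    rw [hij, Finset.prod_range_succ, hrj, mul_assoc, div_mul_cancel₀ _ hT'0]
  intro i j
  by_cases h1 : (i : ℕ) = j
  · obtain rfl := Fin.ext h1
    rw [hdiag]
  by_cases h2 : (i : ℕ) = j + 1
  · exact hlow i j h2
  by_cases h3 : (j : ℕ) = i + 1
  · have e := hlow j i h3
    have hT0 : T j i ≠ 0 := hT.2 j i (by omega)
    have hT'0 : T' j i ≠ 0 := hT'.2 j i (by omega)
    refine mul_right_cancel₀ (mul_ne_zero hT0 hT'0) ?_
    simp only
    linear_combination (∏ k ∈ Finset.range i, r k) * T j i * hmul i j - T i j * T j i * e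
  · have e1 : T i j = 0 := by
      by_contra h
      have := hT.1 i j h
      omega
    have e2 : T' i j = 0 := by
      by_contra h
      have := hT'.1 i j h
      omega
    rw [e1, e2, mul_zero, mul_zero]

end Uniqueness

/-! ### Passage between Leonard systems and matrices -/

section PrimitiveIdempotents

variable {F : Type*} [Field F] {V : Type*} [AddCommGroup V] [Module F V] {d : ℕ}

theorem IsPrimitiveIdempotents.apply_basis {A : End F V} {θ : Fin (d + 1) → F}
    {E : Fin (d + 1) → End F V} (h : IsPrimitiveIdempotents A θ E) {b : Basis (Fin (d + 1)) F V}
    (hb : ∀ i, b i ∈ A.eigenspace (θ i)) (i j : Fin (d + 1)) :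
    E i (b j) = if i = j then b j else 0 := by
  split_ifs with hij
  · subst hij
    exact h.apply_self i _ (hb i)
  · exact h.apply_of_ne i j (Ne.symm hij) _ (hb j)

theorem IsPrimitiveIdempotents.trace_mul {A : End F V} {θ : Fin (d + 1) → F}
    {E : Fin (d + 1) → End F V} (h : IsPrimitiveIdempotents A θ E) {b : Basis (Fin (d + 1)) F V}
    (hb : ∀ i, b i ∈ A.eigenspace (θ i)) (i : Fin (d + 1)) (X : End F V) :
    LinearMap.trace F V (X * E i) = LinearMap.toMatrix b b X i i := by
  rw [LinearMap.trace_eq_matrix_trace F b, Matrix.trace, Finset.sum_eq_single i]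
  · rw [Matrix.diag_apply, LinearMap.toMatrix_apply, LinearMap.toMatrix_apply, Module.End.mul_apply,
      h.apply_basis hb, if_pos rfl]
  · intro j _ hj
    rw [Matrix.diag_apply, LinearMap.toMatrix_apply, Module.End.mul_apply, h.apply_basis hb,
      if_neg (Ne.symm hj), map_zero, map_zero, Finsupp.zero_apply]
  · simp

theorem toMatrix_eq_diagonal {A : End F V} {θ : Fin (d + 1) → F} {b : Basis (Fin (d + 1)) F V}
    (hb : ∀ i, b i ∈ A.eigenspace (θ i)) : LinearMap.toMatrix b b A = Matrix.diagonal θ := by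
  ext i j
  rw [LinearMap.toMatrix_apply, Module.End.mem_eigenspace_iff.1 (hb j), map_smul, Basis.repr_self,
    Finsupp.smul_single, smul_eq_mul, mul_one, Matrix.diagonal_apply, Finsupp.single_apply]
  by_cases hij : i = j
  · simp [hij]
  · rw [if_neg hij, if_neg (Ne.symm hij)]

end PrimitiveIdempotents

namespace LeonardSystem

variable {F : Type*} [Field F] {V : Type*} [AddCommGroup V] [Module F V] {d : ℕ}

theorem exists_bases (Φ : LeonardSystem F V d) :
    ∃ v w : Basis (Fin (d + 1)) F V,
      (∀ i, v i ∈ Φ.Astar.eigenspace (Φ.θstar i)) ∧ (∀ i, w i ∈ Φ.A.eigenspace (Φ.θ i)) ∧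
      IsLeonardMatrices Φ.θ Φ.θstar (LinearMap.toMatrix v v Φ.A) (LinearMap.toMatrix w w Φ.Astar)
        (v.toMatrix w) (w.toMatrix v) := by
  obtain ⟨w, hw, hB, -⟩ := Φ.standard.choose_spec.2
  obtain ⟨v, hv, hT, -⟩ := Φ.standard_star.choose_spec.2
  refine ⟨v, w, hv, hw, Φ.isPrimitiveIdempotents.injective, Φ.isPrimitiveIdempotents_star.injective,
    hT, hB, v.toMatrix_mul_toMatrix_flip w, w.toMatrix_mul_toMatrix_flip v, ?_, ?_⟩
  · have := toMatrix_eq_diagonal hw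
    rw [θ, ← this, linearMap_toMatrix_mul_basis_toMatrix, basis_toMatrix_mul_linearMap_toMatrix]
  · have := toMatrix_eq_diagonal hv
    rw [θstar, ← this, linearMap_toMatrix_mul_basis_toMatrix, basis_toMatrix_mul_linearMap_toMatrix]

theorem splitTrace_eq (Φ : LeonardSystem F V d) {v : Basis (Fin (d + 1)) F V}
    (hv : ∀ i, v i ∈ Φ.Astar.eigenspace (Φ.θstar i)) (t : Fin (d + 1) → F) (k : ℕ) :
    Φ.splitTrace t k =
      Polynomial.aeval (LinearMap.toMatrix v v Φ.A) (initialProd t k) 0 0 := by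
  rw [splitTrace, LinearMap.trace_mul_comm, Φ.isPrimitiveIdempotents_star.trace_mul hv]
  have := Polynomial.aeval_algHom_apply (LinearMap.toMatrixAlgEquiv v).toAlgHom Φ.A (initialProd t k)
  exact (congrFun (congrFun this 0) 0).symm

/-- The first split parameters are `(a_0 - θ_0)` and `(a_0 - θ_d)` times `θs_0 - θs_1`; by
`last_split` and the corner relations the last ones are `(a_d - θ_d)` and `(a_d - θ_0)` times `θs_d
- θs_{d-1}`. The `a_0` and `a_d` cancel. -/
theorem vphi_add_sub (Φ : LeonardSystem F V d) (hd : 1 ≤ d) :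
    Φ.vphi ⟨1, by omega⟩ + Φ.vphi (Fin.last d) - (Φ.phi ⟨1, by omega⟩ + Φ.phi (Fin.last d)) =
      (Φ.θ (Fin.last d) - Φ.θ 0) * ((Φ.θstar 0 - Φ.θstar ⟨1, by omega⟩) -
        (Φ.θstar (Fin.last d) - Φ.θstar ⟨d - 1, by omega⟩)) := by
  obtain ⟨v, w, hv, -, h⟩ := Φ.exists_bases
  have s3 := h.rev.rev_star.first_relation hd
  have s4 := h.rev_star.first_relation hd
  have l1 := h.last_split hd
  have l2 := h.rev.last_split hd
  simp only [Matrix.submatrix_apply, Fin.rev_zero, Fin.rev_last, IsLeonardMatrices.rev_one hd] at s3 s4 l2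
  rw [show (⟨d - 1, by omega⟩ : Fin (d + 1)).rev = ⟨1, by omega⟩ from
    Fin.ext (by simp [Fin.val_rev]; omega)] at l2
  simp only [vphi, phi, Φ.splitTrace_eq hv, Fin.val_last, Nat.sub_self, l1, l2, initialProd_zero,
    aeval_initialProd_one, map_one, Matrix.one_apply_eq, div_one, Fin.rev_zero]
  linear_combination s4 - s3

/-- The map sending `v i` to `s i • v' i` intertwines `A` by `hA` and `A*` because the eigenvalues
agree. It therefore carries eigenbases to eigenbases, which determine the primitive idempotents. -/
theorem isIsomorphic_of_scaling {V' : Type*} [AddCommGroup V'] [Module F V']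
    (Φ : LeonardSystem F V d) (Φ' : LeonardSystem F V' d) (hθ : Φ.θ = Φ'.θ)
    (hθs : Φ.θstar = Φ'.θstar) {v : Basis (Fin (d + 1)) F V} {v' : Basis (Fin (d + 1)) F V'}
    (hv : ∀ i, v i ∈ Φ.Astar.eigenspace (Φ.θstar i))
    (hv' : ∀ i, v' i ∈ Φ'.Astar.eigenspace (Φ'.θstar i)) {w : Basis (Fin (d + 1)) F V}
    (hw : ∀ i, w i ∈ Φ.A.eigenspace (Φ.θ i)) {s : Fin (d + 1) → F} (hs : ∀ i, s i ≠ 0)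
    (hA : ∀ i j, s i * LinearMap.toMatrix v v Φ.A i j = s j * LinearMap.toMatrix v' v' Φ'.A i j) :
    Φ.IsIsomorphic Φ' := by
  set σ : V ≃ₗ[F] V' :=
    v.equiv (v'.isUnitSMul fun i => (hs i).isUnit) (Equiv.refl _) with hσ
  have hσv : ∀ i, σ (v i) = s i • v' i := fun i => by
    rw [hσ, Basis.equiv_apply, Basis.isUnitSMul_apply, Equiv.refl_apply]
  have hσA : ∀ x, σ (Φ.A x) = Φ'.A (σ x) := by
    intro x
    refine LinearMap.congr_fun (f := σ.toLinearMap ∘ₗ Φ.A) (g := Φ'.A ∘ₗ σ.toLinearMap)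
      (v.ext fun j => ?_) x
    simp only [LinearMap.comp_apply, LinearEquiv.coe_coe, hσv, map_smul]
    rw [← v.sum_repr (Φ.A (v j)), ← v'.sum_repr (Φ'.A (v' j)), map_sum, Finset.smul_sum]
    refine Finset.sum_congr rfl fun i _ => ?_
    rw [map_smul, hσv, smul_smul, smul_smul, ← LinearMap.toMatrix_apply,
      ← LinearMap.toMatrix_apply, mul_comm, hA]
  have hσAs : ∀ x, σ (Φ.Astar x) = Φ'.Astar (σ x) := by
    intro x
    refine LinearMap.congr_fun (f := σ.toLinearMap ∘ₗ Φ.Astar) (g := Φ'.Astar ∘ₗ σ.toLinearMap)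
      (v.ext fun j => ?_) x
    simp only [LinearMap.comp_apply, LinearEquiv.coe_coe, hσv, map_smul,
      Module.End.mem_eigenspace_iff.1 (hv j), Module.End.mem_eigenspace_iff.1 (hv' j), hθs]
    rw [smul_comm]
  refine ⟨σ, hσA, hσAs, fun i x => ?_, fun i x => ?_⟩
  · refine LinearMap.congr_fun (f := σ.toLinearMap ∘ₗ Φ.E i) (g := Φ'.E i ∘ₗ σ.toLinearMap)
      (w.ext fun j => ?_) x
    have hmem : ∀ j, (w.map σ) j ∈ Φ'.A.eigenspace (Φ'.θ j) := by
      intro j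
      rw [Module.End.mem_eigenspace_iff, Basis.map_apply, ← hσA,
        Module.End.mem_eigenspace_iff.1 (hw j), map_smul, hθ]
    have e := Φ'.isPrimitiveIdempotents.apply_basis hmem i j
    rw [Basis.map_apply] at e
    simp only [LinearMap.comp_apply, LinearEquiv.coe_coe, e,
      Φ.isPrimitiveIdempotents.apply_basis hw i j]
    split_ifs <;> simp
  · refine LinearMap.congr_fun (f := σ.toLinearMap ∘ₗ Φ.Estar i)
      (g := Φ'.Estar i ∘ₗ σ.toLinearMap) (v.ext fun j => ?_) x
    simp only [LinearMap.comp_apply, LinearEquiv.coe_coe, hσv, map_smul,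
      Φ.isPrimitiveIdempotents_star.apply_basis hv i j,
      Φ'.isPrimitiveIdempotents_star.apply_basis hv' i j]
    split_ifs <;> simp [hσv]

end LeonardSystem

theorem mainTheorem2 {F : Type*} [Field F] [IsAlgClosed F] {d : ℕ} (hd : 3 ≤ d)
    {V : Type*} [AddCommGroup V] [Module F V]
    {V' : Type*} [AddCommGroup V'] [Module F V']
    (Φ : LeonardSystem F V d)
    (hΦ : Φ.vphi ⟨1, by omega⟩ + Φ.vphi (Fin.last d) ≠
      Φ.phi ⟨1, by omega⟩ + Φ.phi (Fin.last d))
    (Φ' : LeonardSystem F V' d)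
    (hβ : Φ'.fundamentalParameter hd = Φ.fundamentalParameter hd)
    (hend : Φ'.endEntries = Φ.endEntries) :
    Φ'.IsIsomorphic Φ := by
  obtain ⟨v, w, hv, hw, h⟩ := Φ.exists_bases
  obtain ⟨v', w', hv', hw', h'⟩ := Φ'.exists_bases
  have e0 := congrFun hend 0
  have e1 := congrFun hend 1
  have e2 := congrFun hend 2
  have e3 := congrFun hend 3
  have e4 : Φ'.a 0 = Φ.a 0 := congrFun hend 4
  have e5 : Φ'.a (Fin.last d) = Φ.a (Fin.last d) := congrFun hend 5
  have e6 : Φ'.astar 0 = Φ.astar 0 := congrFun hend 6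
  have e7 : Φ'.astar (Fin.last d) = Φ.astar (Fin.last d) := congrFun hend 7
  simp only [LeonardSystem.a, Φ.isPrimitiveIdempotents_star.trace_mul hv,
    Φ'.isPrimitiveIdempotents_star.trace_mul hv'] at e4 e5
  simp only [LeonardSystem.astar, Φ.isPrimitiveIdempotents.trace_mul hw,
    Φ'.isPrimitiveIdempotents.trace_mul hw'] at e6 e7
  -- By `vphi_add_sub`, equal end gaps would contradict `hΦ`.
  have hne : Φ.θstar 0 - Φ.θstar ⟨1, by omega⟩ ≠
      Φ.θstar (Fin.last d) - Φ.θstar ⟨d - 1, by omega⟩ := by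
    intro h0
    have := Φ.vphi_add_sub (by omega)
    rw [h0, sub_self, mul_zero, sub_eq_zero] at this
    exact hΦ this
  have hβ' : (natExt Φ'.θ 0 - natExt Φ'.θ 3) / (natExt Φ'.θ 1 - natExt Φ'.θ 2) =
      (natExt Φ.θ 0 - natExt Φ.θ 3) / (natExt Φ.θ 1 - natExt Φ.θ 2) := by
    have z : ∀ t : Fin (d + 1) → F, natExt t 0 = t ⟨0, by omega⟩ ∧ natExt t 1 = t ⟨1, by omega⟩ ∧
        natExt t 2 = t ⟨2, by omega⟩ ∧ natExt t 3 = t ⟨3, by omega⟩ :=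
      fun t => ⟨natExt_eq t _, natExt_eq t _, natExt_eq t _, natExt_eq t _⟩
    simp only [z]
    exact sub_left_injective hβ
  obtain ⟨hθ, hθs⟩ := h.eigenvalues_eq h' hd hne hβ' e0 e1 e2 e3 e4 e5 e6 e7
  rw [hθ, hθs] at h'
  obtain ⟨hdiag, hmul⟩ := h.mul_eq_of_ends h' hd e4 e5 e6 e7
  obtain ⟨s, hs, hA⟩ := h.irred.exists_scaling h'.irred hdiag hmul
  exact Φ'.isIsomorphic_of_scaling Φ hθ hθs hv' hv hw' hs hA
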